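/- Let $\alpha>0$, $\sigma=3\sqrt{\alpha}$, $\lambda\in\mathbb R\setminus\{-1\}$, and for $\varepsilon>0$ consider the planar non-autonomous Filippov system $$ (x',y')=\begin{cases}X^+_\varepsilon(t,x,y)=\bigl(1,\;x^2-\alpha+\varepsilon\lambda\sin(\pi t/\sigma)\bigr), & y>0,\\[2pt] X^-_\varepsilon(t,x,y)=\bigl(-1,\;x^2-\alpha+\varepsilon\sin(\pi t/\sigma)\bigr), & y<0,\end{cases} $$ with switching manifold $\Sigma=\{(t,x,y): y=0\}$ in the extended phase space. Put $p_v=(\sqrt\alpha,0)$ and write $X^\pm_{\varepsilon,2}$ for the second component of $X^\pm_\varepsilon$. Let $$\Sigma^s=\{X^+_{\varepsilon,2}<0<X^-_{\varepsilon,2}\},\quad \Sigma^e=\{X^-_{\varepsilon,2}<0<X^+_{\varepsilon,2}\},\quad \Sigma^c=\{X^+_{\varepsilon,2}X^-_{\varepsilon,2}>0\}$$ be the sliding, escaping and crossing regions of $\Sigma$; on $\Sigma^s\cup\Sigma^e$ the sliding vector field is $\dfrac{X^-_{\varepsilon,2}X^+_\varepsilon-X^+_{\varepsilon,2}X^-_\varepsilon}{X^-_{\varepsilon,2}-X^+_{\varepsilon,2}}$.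 Solutions are understood in the sense of Filippov: locally absolutely continuous curves $u:\mathbb R\to\mathbb R^2$ with $u'(t)$, for almost every $t$, equal to $X^\pm_\varepsilon(t,u(t))$ when $u(t)\in\{\pm y>0\}$ and in the segment $[X^+_\varepsilon(t,u(t)),X^-_\varepsilon(t,u(t))]$ when $u(t)\in\{y=0\}$. A periodic solution $u$ is called *crossing* if $(t,u(t))$ meets $\Sigma$, and only at points of $\Sigma^c$. It is called *sliding*, and is said to slide on $R$ (with $R=\Sigma^s$ or $R=\Sigma^e$), if on some nondegenerate time interval $(t,u(t))$ stays in $R$ and $u$ is a trajectory of the sliding vector field, and every point $(t,u(t))$ lying in $\Sigma^s\cup\Sigma^e$ lies in $R$. "With initial condition $\varepsilon$-close to $(t_0,z_0)$" means that there is a constant $C$, independent of $\varepsilon$, such that for some $t_\varepsilon$ one has $|t_\varepsilon-t_0|\le C\varepsilon$ and $|u(t_\varepsilon)-z_0|\le C\varepsilon$. Then, for all sufficiently small $\varepsilon>0$, the following hold. (i) If $\lambda\ne1$, there exists a sliding $6\sqrt\alpha$-periodic solution with initial condition $\varepsilon$-close to $(3\sqrt\alpha/2,\,p_v)$; it slides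 on $\Sigma^s$ if $\lambda<1$ and on $\Sigma^e$ if $\lambda>1$. (ii) If $\lambda<0$, there exists a sliding $6\sqrt\alpha$-periodic solution with initial condition $\varepsilon$-close to $(9\sqrt\alpha/2,\,p_v)$; it slides on $\Sigma^e$. (iii) If $\lambda>0$, there exists a crossing $6\sqrt\alpha$-periodic solution with initial condition $\varepsilon$-close to $(9\sqrt\alpha/2,\,p_v)$. -/

import Mathlib

/-- A (time-dependent) piecewise smooth planar system with switching line `y = 0`: the field `pos`
governs the half plane `y > 0` and the field `neg` governs the half plane `y < 0`. -/
structure PiecewiseSystem where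
  pos : ℝ → ℝ × ℝ → ℝ × ℝ
  neg : ℝ → ℝ × ℝ → ℝ × ℝ

namespace PiecewiseSystem

/-- Filippov's set-valued right-hand side: single-valued off the switching line, the convex hull of
the two one-sided vectors on it. -/
def filippovSet (Z : PiecewiseSystem) (t : ℝ) (p : ℝ × ℝ) : Set (ℝ × ℝ) :=
  {v | (0 < p.2 ∧ v = Z.pos t p) ∨ (p.2 < 0 ∧ v = Z.neg t p) ∨
    (p.2 = 0 ∧ v ∈ segment ℝ (Z.pos t p) (Z.neg t p))}

/-- A (global) Filippov solution: a locally absolutely continuous curve whose velocity lies in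
Filippov's set for almost every time. -/
def IsFilippovSolution (Z : PiecewiseSystem) (u : ℝ → ℝ × ℝ) : Prop :=
  (∀ a b : ℝ, AbsolutelyContinuousOnInterval u a b) ∧
    ∀ᵐ t : ℝ, ∃ v ∈ Z.filippovSet t (u t), HasDerivAt u v t

/-- The switching manifold in the extended phase space `(t, (x, y))`. The derivative of
`h (x, y) = y` along a vector is its second component. -/
def switching : Set (ℝ × ℝ × ℝ) := {q | q.2.2 = 0}

/-- The sliding region `Σˢ`: both fields point towards the switching manifold. -/
def slidingRegion (Z : PiecewiseSystem) : Set (ℝ × ℝ × ℝ) :=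
  {q | q ∈ switching ∧ (Z.pos q.1 q.2).2 < 0 ∧ 0 < (Z.neg q.1 q.2).2}

/-- The escaping region `Σᵉ`: both fields point away from the switching manifold. -/
def escapingRegion (Z : PiecewiseSystem) : Set (ℝ × ℝ × ℝ) :=
  {q | q ∈ switching ∧ 0 < (Z.pos q.1 q.2).2 ∧ (Z.neg q.1 q.2).2 < 0}

/-- The crossing region `Σᶜ`: both fields are transversal and point to the same side. -/
def crossingRegion (Z : PiecewiseSystem) : Set (ℝ × ℝ × ℝ) :=
  {q | q ∈ switching ∧ 0 < (Z.pos q.1 q.2).2 * (Z.neg q.1 q.2).2}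

/-- The sliding vector field `(X⁻h · X⁺ - X⁺h · X⁻) / (X⁻h - X⁺h)`. -/
noncomputable def slidingField (Z : PiecewiseSystem) (t : ℝ) (p : ℝ × ℝ) : ℝ × ℝ :=
  ((Z.neg t p).2 - (Z.pos t p).2)⁻¹ •
    ((Z.neg t p).2 • Z.pos t p - (Z.pos t p).2 • Z.neg t p)

/-- `u` is a `T`-periodic sliding solution, sliding on `R` (to be used with `R = Σˢ` or `R = Σᵉ`):
it is a `T`-periodic Filippov solution which on some nondegenerate time interval stays in `R`, where
it is a trajectory of the sliding vector field, and all its points in `Σˢ ∪ Σᵉ` belong to `R`. -/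
def IsSlidingPeriodicSolution (Z : PiecewiseSystem) (T : ℝ) (R : Set (ℝ × ℝ × ℝ))
    (u : ℝ → ℝ × ℝ) : Prop :=
  Z.IsFilippovSolution u ∧ Function.Periodic u T ∧
    (∃ a b : ℝ, a < b ∧ ∀ t ∈ Set.Ioo a b,
      (t, u t) ∈ R ∧ HasDerivAt u (Z.slidingField t (u t)) t) ∧
    ∀ t : ℝ, (t, u t) ∈ Z.slidingRegion ∪ Z.escapingRegion → (t, u t) ∈ R

/-- `u` is a `T`-periodic crossing solution: a `T`-periodic Filippov solution which meets the
switching manifold, and does so at points of the crossing region only. -/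
def IsCrossingPeriodicSolution (Z : PiecewiseSystem) (T : ℝ) (u : ℝ → ℝ × ℝ) : Prop :=
  Z.IsFilippovSolution u ∧ Function.Periodic u T ∧
    (∃ t : ℝ, (t, u t) ∈ switching) ∧
    ∀ t : ℝ, (t, u t) ∈ switching → (t, u t) ∈ Z.crossingRegion

end PiecewiseSystem

/-- The perturbed piecewise Hamiltonian model
`(x', y') = (1, x² - α + ε λ sin (π t / σ))` for `y > 0`,
`(x', y') = (-1, x² - α + ε sin (π t / σ))` for `y < 0`. -/
noncomputable def hamiltonianModel (α lam σ ε : ℝ) : PiecewiseSystem where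
  pos t p := (1, p.1 ^ 2 - α) + ε • (0, lam * Real.sin (Real.pi * t / σ))
  neg t p := (-1, p.1 ^ 2 - α) + ε • (0, Real.sin (Real.pi * t / σ))

/-- For all sufficiently small `ε > 0` there is a solution of type `P ε` with initial condition
`ε`-close, that is within `O(ε)`, to `(θ, z)`. -/
def HasSolutionsNear (P : ℝ → (ℝ → ℝ × ℝ) → Prop) (θ : ℝ) (z : ℝ × ℝ) : Prop :=
  ∃ C > 0, ∃ ε₀ > 0, ∀ ε : ℝ, 0 < ε → ε < ε₀ →
    ∃ (t₀ : ℝ) (u : ℝ → ℝ × ℝ), P ε u ∧ |t₀ - θ| ≤ C * ε ∧ dist (u t₀) z ≤ C * ε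

open Set Filter Topology

/-! ### Gluing and periodic extension of Lipschitz curves -/

/-! With `a = √α`, the weights `a`, `a`, `a ^ 3` for `t`, `x`, `y` reduce everything to `α = 1`, and
moving the time origin to `3 * a / 2` or `9 * a / 2` turns the sine into plus or minus `forcing`.
The reversal `(t, x, y) ↦ (-t, x, -y)` exchanges the two fields, hence sliding and escaping. So two
normalized orbits suffice: a sliding one with amplitudes `ε * lam` above and `ε` below, `lam < 1`,
and a crossing one with negative amplitudes. The escaping cases `lam > 1` and `lam < 0` are
reversals of the sliding one with ratio `lam⁻¹ < 1`.

At `ε = 0` the orbit through the double fold `(1, 0)` goes below the line to `(-2, 0)` in time 3 and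
returns above it in time 3. For the sliding orbit, let it leave the fold of the lower field at an
unknown time `s` near 0. The lower arc lasts slightly less than 3 (`exists_lower_duration`).
Backward from the fold at time `s + 6`, barriers trap the sliding flow inside the sliding region
with forward speed at most `1/2` (`slidingArc_bounds`). The upper arc has horizontal speed 1, so its
abscissa meets the sliding arc at a time `d = O(ε)` before `s + 6`, and `d` is continuous in `s`
(`exists_landing`). One scalar equation remains: the upper arc must have height 0 at that moment.
Because 1 is a critical point of `cubic`, this height is `2 * ε * (1 + lam) * forcingPrimitive s +
O(ε²)`, a Melnikov function with a simple zero at 0 when `lam ≠ -1`. The intermediate value theorem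
gives `s = O(ε)` (`exists_matching`).

The crossing orbit is explicit: with negative amplitudes the forcing pushes each arc further to its
own side of the line, and the arcs close up exactly because `forcingPrimitive` vanishes at 0, 3 and
6. -/

theorem LipschitzOnWith.Icc_union {X : Type*} [PseudoMetricSpace X] {K : NNReal} {f : ℝ → X}
    {a b c : ℝ} (hab : a ≤ b) (hbc : b ≤ c) (h₁ : LipschitzOnWith K f (Icc a b))
    (h₂ : LipschitzOnWith K f (Icc b c)) : LipschitzOnWith K f (Icc a c) := by
  have key : ∀ x ∈ Icc a c, ∀ y ∈ Icc a c, x ≤ y → dist (f x) (f y) ≤ K * (y - x) := by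
    intro x hx y hy hxy
    rcases le_total y b with hyb | hyb
    · have := h₁.dist_le_mul x ⟨hx.1, hxy.trans hyb⟩ y ⟨hy.1, hyb⟩
      rwa [dist_comm x y, Real.dist_eq, abs_of_nonneg (sub_nonneg.2 hxy)] at this
    rcases le_total b x with hbx | hbx
    · have := h₂.dist_le_mul x ⟨hbx, hx.2⟩ y ⟨hyb, hy.2⟩
      rwa [dist_comm x y, Real.dist_eq, abs_of_nonneg (sub_nonneg.2 hxy)] at this
    have e₁ := h₁.dist_le_mul x ⟨hx.1, hbx⟩ b ⟨hab, le_rfl⟩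
    have e₂ := h₂.dist_le_mul b ⟨le_rfl, hbc⟩ y ⟨hyb, hy.2⟩
    rw [dist_comm x b, Real.dist_eq, abs_of_nonneg (sub_nonneg.2 hbx)] at e₁
    rw [dist_comm b y, Real.dist_eq, abs_of_nonneg (sub_nonneg.2 hyb)] at e₂
    linarith [dist_triangle (f x) (f b) (f y)]
  refine LipschitzOnWith.of_dist_le_mul fun x hx y hy => ?_
  rcases le_total x y with h | h
  · rw [dist_comm x y, Real.dist_eq, abs_of_nonneg (sub_nonneg.2 h)]
    exact key x hx y hy h
  · rw [dist_comm (f x), Real.dist_eq, abs_of_nonneg (sub_nonneg.2 h)]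
    exact key y hy x hx h

/-- Times in different periods are compared through the seam value `v a`: the piece up to `a + T`
and the piece from `a` together are no longer than `y - x`, as the integer quotients differ by at
least 1. -/
theorem LipschitzOnWith.comp_toIcoMod {X : Type*} [PseudoMetricSpace X] {K : NNReal}
    {v : ℝ → X} {a T : ℝ} (hT : 0 < T) (hv : LipschitzOnWith K v (Icc a (a + T)))
    (hend : v (a + T) = v a) : LipschitzWith K fun t => v (toIcoMod hT a t) := by
  have key : ∀ x y : ℝ, x ≤ y →
      dist (v (toIcoMod hT a x)) (v (toIcoMod hT a y)) ≤ K * (y - x) := by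
    intro x y hxy
    have ex := toIcoMod_add_toIcoDiv_zsmul hT a x
    have ey := toIcoMod_add_toIcoDiv_zsmul hT a y
    have mx := toIcoMod_mem_Ico hT a x
    have my := toIcoMod_mem_Ico hT a y
    set p := toIcoMod hT a x
    set r := toIcoMod hT a y
    simp only [zsmul_eq_mul] at ex ey
    have hp : p ∈ Icc a (a + T) := ⟨mx.1, mx.2.le⟩
    have hr : r ∈ Icc a (a + T) := ⟨my.1, my.2.le⟩
    rcases lt_trichotomy (toIcoDiv hT a x) (toIcoDiv hT a y) with h | h | h
    · have h' : (toIcoDiv hT a x : ℝ) + 1 ≤ toIcoDiv hT a y := by exact_mod_cast h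
      have e₁ := hv.dist_le_mul p hp (a + T) ⟨by linarith, le_rfl⟩
      have e₂ := hv.dist_le_mul a ⟨le_rfl, by linarith⟩ r hr
      rw [dist_comm p, Real.dist_eq, abs_of_nonneg (sub_nonneg.2 hp.2), hend] at e₁
      rw [dist_comm a r, Real.dist_eq, abs_of_nonneg (sub_nonneg.2 hr.1)] at e₂
      have : K * (a + T - p) + K * (r - a) ≤ K * (y - x) := by
        rw [← mul_add]
        refine mul_le_mul_of_nonneg_left ?_ K.2
        nlinarith
      linarith [dist_triangle (v p) (v a) (v r)]
    · have e := hv.dist_le_mul p hp r hr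
      have hpr : r - p = y - x := by rw [← ex, ← ey, h]; ring
      rwa [dist_comm p r, Real.dist_eq, hpr, abs_of_nonneg (sub_nonneg.2 hxy)] at e
    · have h' : (toIcoDiv hT a y : ℝ) + 1 ≤ toIcoDiv hT a x := by exact_mod_cast h
      have := mx.1
      have := my.2
      nlinarith
  refine LipschitzWith.of_dist_le_mul fun x y => ?_
  rcases le_total x y with h | h
  · rw [dist_comm x y, Real.dist_eq, abs_of_nonneg (sub_nonneg.2 h)]
    exact key x y h
  · rw [dist_comm (v _), Real.dist_eq, abs_of_nonneg (sub_nonneg.2 h)]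
    exact key y x h

/-- Away from the seam the integer quotient is locally constant, so derivatives pass to the
extension. -/
theorem toIcoMod_comp_eventuallyEq {X : Type*} {v : ℝ → X} {a T t : ℝ} (hT : 0 < T)
    (ht : toIcoMod hT a t ∈ Ioo a (a + T)) :
    (fun s => v (toIcoMod hT a s)) =ᶠ[𝓝 t] fun s => v (s - toIcoDiv hT a t • T) := by
  have hc : ContinuousAt (fun s : ℝ => s - toIcoDiv hT a t • T) t := by fun_prop
  filter_upwards [hc.preimage_mem_nhds (isOpen_Ioo.mem_nhds ht)] with s hs
  congr 1
  exact (toIcoMod_eq_iff hT).2 ⟨⟨hs.1.le, hs.2⟩, toIcoDiv hT a t, by ring⟩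

/-- A Lipschitz curve whose velocity lies in Filippov's set off a countable set of times. -/
def PiecewiseSystem.IsLipschitzSolution (Z : PiecewiseSystem) (u : ℝ → ℝ × ℝ) : Prop :=
  (∃ K, LipschitzWith K u) ∧
    ∃ N : Set ℝ, N.Countable ∧ ∀ t ∉ N, ∃ v ∈ Z.filippovSet t (u t), HasDerivAt u v t

/-- A system that is `T`-periodic in time. -/
def PiecewiseSystem.IsTimePeriodic (Z : PiecewiseSystem) (T : ℝ) : Prop :=
  Function.Periodic Z.pos T ∧ Function.Periodic Z.neg T

namespace PiecewiseSystem

variable {Z : PiecewiseSystem} {u v : ℝ → ℝ × ℝ} {T : ℝ}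

theorem IsLipschitzSolution.isFilippovSolution (h : Z.IsLipschitzSolution u) :
    Z.IsFilippovSolution u := by
  obtain ⟨⟨K, hK⟩, N, hN, h⟩ := h
  refine ⟨fun a b => (hK.lipschitzOnWith).absolutelyContinuousOnInterval, ?_⟩
  filter_upwards [hN.ae_notMem MeasureTheory.volume] with t ht using h t ht

theorem IsTimePeriodic.mem_slidingRegion_sub_zsmul (hZ : Z.IsTimePeriodic T) (n : ℤ) (t : ℝ)
    (p : ℝ × ℝ) : (t - n • T, p) ∈ Z.slidingRegion ↔ (t, p) ∈ Z.slidingRegion := by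
  simp only [slidingRegion, switching, mem_ofPred_eq, hZ.1.sub_zsmul_eq n, hZ.2.sub_zsmul_eq n]

theorem IsTimePeriodic.mem_escapingRegion_sub_zsmul (hZ : Z.IsTimePeriodic T) (n : ℤ) (t : ℝ)
    (p : ℝ × ℝ) : (t - n • T, p) ∈ Z.escapingRegion ↔ (t, p) ∈ Z.escapingRegion := by
  simp only [escapingRegion, switching, mem_ofPred_eq, hZ.1.sub_zsmul_eq n, hZ.2.sub_zsmul_eq n]

theorem IsTimePeriodic.mem_crossingRegion_sub_zsmul (hZ : Z.IsTimePeriodic T) (n : ℤ) (t : ℝ)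
    (p : ℝ × ℝ) : (t - n • T, p) ∈ Z.crossingRegion ↔ (t, p) ∈ Z.crossingRegion := by
  simp only [crossingRegion, switching, mem_ofPred_eq, hZ.1.sub_zsmul_eq n, hZ.2.sub_zsmul_eq n]

theorem slidingField_mem_filippovSet {t : ℝ} {p : ℝ × ℝ}
    (h : (t, p) ∈ Z.slidingRegion) : Z.slidingField t p ∈ Z.filippovSet t p := by
  obtain ⟨h₀, h₁, h₂⟩ := h
  refine Or.inr (Or.inr ⟨h₀, ?_⟩)
  simp only at h₁ h₂
  have hd : 0 < (Z.neg t p).2 - (Z.pos t p).2 := by linarith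
  refine ⟨((Z.neg t p).2 - (Z.pos t p).2)⁻¹ * (Z.neg t p).2,
    ((Z.neg t p).2 - (Z.pos t p).2)⁻¹ * (-(Z.pos t p).2), by positivity,
    mul_nonneg (inv_nonneg.2 hd.le) (by linarith), ?_, ?_⟩
  · rw [← mul_add, ← sub_eq_add_neg, inv_mul_cancel₀ hd.ne']
  · rw [slidingField, smul_sub, smul_smul, smul_smul, mul_neg, neg_smul, ← sub_eq_add_neg]

/-- The `T`-periodic extension of a closed solution arc is a solution. -/
theorem IsTimePeriodic.isLipschitzSolution_comp_toIcoMod (hZ : Z.IsTimePeriodic T) (hT : 0 < T)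
    {a : ℝ} {K : NNReal} (hv : LipschitzOnWith K v (Icc a (a + T))) (hend : v (a + T) = v a)
    {N : Set ℝ} (hN : N.Countable)
    (hsol : ∀ t ∈ Ioo a (a + T), t ∉ N → ∃ w ∈ Z.filippovSet t (v t), HasDerivAt v w t) :
    Z.IsLipschitzSolution fun t => v (toIcoMod hT a t) := by
  -- The exceptional times are the translates of `N` and of the seam `a`.
  refine ⟨⟨K, hv.comp_toIcoMod hT hend⟩, ⋃ n : ℤ, (fun t => t + n • T) '' (insert a N),
    countable_iUnion fun n => (hN.insert a).image _, fun t ht => ?_⟩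
  have hm := toIcoMod_mem_Ico hT a t
  have hnot : toIcoMod hT a t ∉ insert a N := fun h =>
    ht (mem_iUnion.2 ⟨toIcoDiv hT a t, _, h, toIcoMod_add_toIcoDiv_zsmul hT a t⟩)
  rw [mem_insert_iff, not_or] at hnot
  have hI : toIcoMod hT a t ∈ Ioo a (a + T) := ⟨lt_of_le_of_ne hm.1 (Ne.symm hnot.1), hm.2⟩
  obtain ⟨w, hw, hd⟩ := hsol _ hI hnot.2
  refine ⟨w, ?_, ?_⟩
  · have e : toIcoMod hT a t = t - toIcoDiv hT a t • T := rfl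
    simp only [filippovSet, mem_ofPred_eq] at hw ⊢
    rw [e, hZ.1.sub_zsmul_eq, hZ.2.sub_zsmul_eq] at hw
    exact hw
  · refine HasDerivAt.congr_of_eventuallyEq ?_ (toIcoMod_comp_eventuallyEq hT hI)
    exact HasDerivAt.comp_sub_const t _ hd

end PiecewiseSystem

/-! ### Scaling and time reversal -/

/-- The system `(x', y') = (±1, x² - α + a(t))` with forcing `a = p` for `y > 0` and `a = n` for
`y < 0`. -/
def foldSystem (α : ℝ) (p n : ℝ → ℝ) : PiecewiseSystem where
  pos t z := (1, z.1 ^ 2 - α + p t)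
  neg t z := (-1, z.1 ^ 2 - α + n t)

namespace PiecewiseSystem

/-- A Lipschitz version of `IsSlidingPeriodicSolution`. -/
def IsLipschitzSlidingSolution (Z : PiecewiseSystem) (T : ℝ) (R : Set (ℝ × ℝ × ℝ))
    (u : ℝ → ℝ × ℝ) : Prop :=
  Z.IsLipschitzSolution u ∧ Function.Periodic u T ∧
    (∃ a b : ℝ, a < b ∧ ∀ t ∈ Set.Ioo a b,
      (t, u t) ∈ R ∧ HasDerivAt u (Z.slidingField t (u t)) t) ∧
    ∀ t : ℝ, (t, u t) ∈ Z.slidingRegion ∪ Z.escapingRegion → (t, u t) ∈ R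

theorem IsLipschitzSlidingSolution.isSlidingPeriodicSolution {Z : PiecewiseSystem} {T : ℝ}
    {R : Set (ℝ × ℝ × ℝ)} {u : ℝ → ℝ × ℝ} (h : Z.IsLipschitzSlidingSolution T R u) :
    Z.IsSlidingPeriodicSolution T R u :=
  ⟨h.1.isFilippovSolution, h.2⟩

end PiecewiseSystem

open PiecewiseSystem

theorem HasDerivAt.fst_real {u : ℝ → ℝ × ℝ} {v : ℝ × ℝ} {t : ℝ} (h : HasDerivAt u v t) :
    HasDerivAt (fun t => (u t).1) v.1 t := by
  simpa using h.hasFDerivAt.fst.hasDerivAt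

theorem HasDerivAt.snd_real {u : ℝ → ℝ × ℝ} {v : ℝ × ℝ} {t : ℝ} (h : HasDerivAt u v t) :
    HasDerivAt (fun t => (u t).2) v.2 t := by
  simpa using h.hasFDerivAt.snd.hasDerivAt

/-- The weight 3 of `y` is forced: `x'` must stay `±1`, so `t` scales like `x`, and `y'` must scale
like `x ^ 2`. -/
theorem hasDerivAt_scaled {u : ℝ → ℝ × ℝ} {v : ℝ × ℝ} {a θ t : ℝ} (ha : 0 < a)
    (h : HasDerivAt u v ((t - θ) / a)) :
    HasDerivAt (fun t => (a * (u ((t - θ) / a)).1, a ^ 3 * (u ((t - θ) / a)).2))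
      (v.1, a ^ 2 * v.2) t := by
  have hg : HasDerivAt (fun t : ℝ => (t - θ) / a) (1 / a) t :=
    ((hasDerivAt_id t).sub_const θ).div_const a
  have hc := HasDerivAt.scomp t h hg
  have h₁ := hc.fst_real.const_mul a
  have h₂ := hc.snd_real.const_mul (a ^ 3)
  refine (h₁.prodMk h₂).congr_deriv ?_
  ext <;> simp <;> field_simp

theorem hasDerivAt_reversed {u : ℝ → ℝ × ℝ} {v : ℝ × ℝ} {t : ℝ}
    (h : HasDerivAt u v (-t)) :
    HasDerivAt (fun t => ((u (-t)).1, -(u (-t)).2)) (-v.1, v.2) t := by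
  have hc := HasDerivAt.scomp t h (hasDerivAt_neg t)
  refine (hc.fst_real.prodMk hc.snd_real.neg).congr_deriv ?_
  ext <;> simp

theorem LipschitzWith.scaled {u : ℝ → ℝ × ℝ} (h : ∃ K, LipschitzWith K u) (a b c d θ : ℝ) :
    ∃ K, LipschitzWith K fun t => (a * (u ((t - θ) * c)).1, b * (u ((t - θ) * d)).2) := by
  obtain ⟨K, hK⟩ := h
  have hg (c : ℝ) : LipschitzWith ‖c‖₊ fun t : ℝ => (t - θ) * c :=
    LipschitzWith.of_dist_le_mul fun x y => by
      rw [Real.dist_eq, Real.dist_eq, coe_nnnorm, Real.norm_eq_abs, ← abs_mul]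
      exact le_of_eq (congrArg _ (by ring))
  have hm (c : ℝ) : LipschitzWith ‖c‖₊ fun t : ℝ => c * t := lipschitzWith_smul c
  exact ⟨_, ((hm a).comp (LipschitzWith.prod_fst.comp (hK.comp (hg c)))).prodMk
    ((hm b).comp (LipschitzWith.prod_snd.comp (hK.comp (hg d))))⟩

section Scaling

variable {p n P N : ℝ → ℝ} {u : ℝ → ℝ × ℝ} {a θ : ℝ}

theorem IsLipschitzSolution.scaled (ha : 0 < a)
    (hP : ∀ t, P t = a ^ 2 * p ((t - θ) / a)) (hN : ∀ t, N t = a ^ 2 * n ((t - θ) / a))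
    (h : (foldSystem 1 p n).IsLipschitzSolution u) :
    (foldSystem (a ^ 2) P N).IsLipschitzSolution
      fun t => (a * (u ((t - θ) / a)).1, a ^ 3 * (u ((t - θ) / a)).2) := by
  obtain ⟨hL, S, hS, h⟩ := h
  refine ⟨by simpa only [div_eq_mul_inv] using LipschitzWith.scaled hL a (a ^ 3) a⁻¹ a⁻¹ θ,
    (fun t => (t - θ) / a) ⁻¹' S, hS.preimage_of_injOn ?_, fun t ht => ?_⟩
  · intro x _ y _ hxy
    simp only at hxy
    field_simp at hxy
    linarith
  · obtain ⟨v, hv, hu⟩ := h _ ht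
    refine ⟨_, ?_, hasDerivAt_scaled ha hu⟩
    have ha3 : 0 < a ^ 3 := by positivity
    rcases hv with ⟨h0, rfl⟩ | ⟨h0, rfl⟩ | ⟨h0, c, d, hc, hd, hcd, rfl⟩
    · refine Or.inl ⟨mul_pos ha3 h0, ?_⟩
      ext
      · simp [foldSystem]
      · simp only [foldSystem, hP]; ring
    · refine Or.inr (Or.inl ⟨mul_neg_of_pos_of_neg ha3 h0, ?_⟩)
      ext
      · simp [foldSystem]
      · simp only [foldSystem, hN]; ring
    · refine Or.inr (Or.inr ⟨by simp [h0], c, d, hc, hd, hcd, ?_⟩)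
      ext
      · simp [foldSystem]
      · simp only [foldSystem, hP, hN, Prod.snd_add, Prod.smul_snd, smul_eq_mul]; ring

theorem mul_neg_iff_of_pos_left {b c : ℝ} (hb : 0 < b) : b * c < 0 ↔ c < 0 := by
  rw [← neg_pos, ← mul_neg, mul_pos_iff_of_pos_left hb, neg_pos]

theorem scaled_pos_snd (hP : ∀ t, P t = a ^ 2 * p ((t - θ) / a)) (t : ℝ) (z : ℝ × ℝ) :
    ((foldSystem (a ^ 2) P N).pos t (a * z.1, a ^ 3 * z.2)).2 =
      a ^ 2 * ((foldSystem 1 p n).pos ((t - θ) / a) z).2 := by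
  simp only [foldSystem, hP]; ring

theorem scaled_neg_snd (hN : ∀ t, N t = a ^ 2 * n ((t - θ) / a)) (t : ℝ) (z : ℝ × ℝ) :
    ((foldSystem (a ^ 2) P N).neg t (a * z.1, a ^ 3 * z.2)).2 =
      a ^ 2 * ((foldSystem 1 p n).neg ((t - θ) / a) z).2 := by
  simp only [foldSystem, hN]; ring

theorem mem_switching_scaled (ha : 0 < a) (t s : ℝ) (z : ℝ × ℝ) :
    (t, a * z.1, a ^ 3 * z.2) ∈ switching ↔ (s, z) ∈ switching := by
  simp [switching, ha.ne']

theorem mem_slidingRegion_scaled (ha : 0 < a)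
    (hP : ∀ t, P t = a ^ 2 * p ((t - θ) / a)) (hN : ∀ t, N t = a ^ 2 * n ((t - θ) / a))
    (t : ℝ) (z : ℝ × ℝ) : (t, a * z.1, a ^ 3 * z.2) ∈ (foldSystem (a ^ 2) P N).slidingRegion ↔
      ((t - θ) / a, z) ∈ (foldSystem 1 p n).slidingRegion := by
  have ha2 : 0 < a ^ 2 := by positivity
  simp only [slidingRegion, mem_ofPred_eq, scaled_pos_snd (n := n) hP, scaled_neg_snd (p := p) hN,
    mem_switching_scaled ha t ((t - θ) / a), mul_pos_iff_of_pos_left ha2, mul_neg_iff_of_pos_left ha2]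

theorem mem_escapingRegion_scaled (ha : 0 < a)
    (hP : ∀ t, P t = a ^ 2 * p ((t - θ) / a)) (hN : ∀ t, N t = a ^ 2 * n ((t - θ) / a))
    (t : ℝ) (z : ℝ × ℝ) : (t, a * z.1, a ^ 3 * z.2) ∈ (foldSystem (a ^ 2) P N).escapingRegion ↔
      ((t - θ) / a, z) ∈ (foldSystem 1 p n).escapingRegion := by
  have ha2 : 0 < a ^ 2 := by positivity
  simp only [escapingRegion, mem_ofPred_eq, scaled_pos_snd (n := n) hP, scaled_neg_snd (p := p) hN,
    mem_switching_scaled ha t ((t - θ) / a), mul_pos_iff_of_pos_left ha2, mul_neg_iff_of_pos_left ha2]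

theorem mem_crossingRegion_scaled (ha : 0 < a)
    (hP : ∀ t, P t = a ^ 2 * p ((t - θ) / a)) (hN : ∀ t, N t = a ^ 2 * n ((t - θ) / a))
    (t : ℝ) (z : ℝ × ℝ) : (t, a * z.1, a ^ 3 * z.2) ∈ (foldSystem (a ^ 2) P N).crossingRegion ↔
      ((t - θ) / a, z) ∈ (foldSystem 1 p n).crossingRegion := by
  have ha2 : 0 < a ^ 2 := by positivity
  simp only [crossingRegion, mem_ofPred_eq, scaled_pos_snd (n := n) hP, scaled_neg_snd (p := p) hN,
    mem_switching_scaled ha t ((t - θ) / a), mul_assoc, mul_left_comm _ (a ^ 2),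
    mul_pos_iff_of_pos_left ha2]

theorem slidingField_scaled (ha : 0 < a)
    (hP : ∀ t, P t = a ^ 2 * p ((t - θ) / a)) (hN : ∀ t, N t = a ^ 2 * n ((t - θ) / a))
    (t : ℝ) (z : ℝ × ℝ) : (foldSystem (a ^ 2) P N).slidingField t (a * z.1, a ^ 3 * z.2) =
      (((foldSystem 1 p n).slidingField ((t - θ) / a) z).1,
        a ^ 2 * ((foldSystem 1 p n).slidingField ((t - θ) / a) z).2) := by
  have ha2 : a ^ 2 ≠ 0 := by positivity
  have e₁ := scaled_pos_snd (N := N) (n := n) hP t z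
  have e₂ := scaled_neg_snd (P := P) (p := p) hN t z
  simp only [slidingField]
  rw [e₁, e₂, ← mul_sub, mul_inv]
  ext
  · simp [foldSystem]
    field_simp
    ring
  · simp only [Prod.smul_snd, Prod.snd_sub, smul_eq_mul, e₁, e₂]
    field_simp

theorem Function.Periodic.scaled {T : ℝ} (ha : 0 < a) (h : Function.Periodic u T) :
    Function.Periodic (fun t => (a * (u ((t - θ) / a)).1, a ^ 3 * (u ((t - θ) / a)).2))
      (T * a) := by
  intro t
  have e : (t + T * a - θ) / a = (t - θ) / a + T := by field_simp; ring
  simp only [e, h _]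

/-- The regions `R` and `R'` enter only through `hR`, so that the sliding and the escaping case are
covered together. -/
theorem IsLipschitzSlidingSolution.scaled {T : ℝ} {R R' : Set (ℝ × ℝ × ℝ)} (ha : 0 < a)
    (hP : ∀ t, P t = a ^ 2 * p ((t - θ) / a)) (hN : ∀ t, N t = a ^ 2 * n ((t - θ) / a))
    (hR : ∀ t z, (t, a * z.1, a ^ 3 * z.2) ∈ R' ↔ ((t - θ) / a, z) ∈ R)
    (h : (foldSystem 1 p n).IsLipschitzSlidingSolution T R u) :
    (foldSystem (a ^ 2) P N).IsLipschitzSlidingSolution (T * a) R'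
      fun t => (a * (u ((t - θ) / a)).1, a ^ 3 * (u ((t - θ) / a)).2) := by
  obtain ⟨h₁, h₂, ⟨b, c, hbc, h₃⟩, h₄⟩ := h
  refine ⟨IsLipschitzSolution.scaled ha hP hN h₁, h₂.scaled ha,
    ⟨a * b + θ, a * c + θ, by nlinarith, fun t ht => ?_⟩, fun t ht => ?_⟩
  · obtain ⟨k₁, k₂⟩ := h₃ ((t - θ) / a)
      ⟨by rw [lt_div_iff₀ ha]; linarith [ht.1], by rw [div_lt_iff₀ ha]; linarith [ht.2]⟩
    refine ⟨(hR _ _).2 k₁, ?_⟩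
    rw [slidingField_scaled ha hP hN]
    exact hasDerivAt_scaled ha k₂
  · refine (hR _ _).2 (h₄ _ ?_)
    rcases ht with ht | ht
    · exact Or.inl ((mem_slidingRegion_scaled ha hP hN _ _).1 ht)
    · exact Or.inr ((mem_escapingRegion_scaled ha hP hN _ _).1 ht)

end Scaling

section Reversal

variable {α : ℝ} {p n P N : ℝ → ℝ} {u : ℝ → ℝ × ℝ}

/-- Reversing time flips the sign of both velocity components and reflecting `y` restores the
second. The lower field thus becomes an upper field, which is why `P` comes from `n` and `N` from
`p`. -/
theorem IsLipschitzSolution.reversed (hP : ∀ t, P t = n (-t)) (hN : ∀ t, N t = p (-t))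
    (h : (foldSystem α p n).IsLipschitzSolution u) :
    (foldSystem α P N).IsLipschitzSolution fun t => ((u (-t)).1, -(u (-t)).2) := by
  obtain ⟨hL, S, hS, h⟩ := h
  refine ⟨by simpa using LipschitzWith.scaled hL 1 (-1) (-1) (-1) 0,
    (fun t => -t) ⁻¹' S, hS.preimage_of_injOn neg_injective.injOn, fun t ht => ?_⟩
  obtain ⟨v, hv, hu⟩ := h _ ht
  refine ⟨_, ?_, hasDerivAt_reversed hu⟩
  rcases hv with ⟨h0, rfl⟩ | ⟨h0, rfl⟩ | ⟨h0, c, d, hc, hd, hcd, rfl⟩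
  · refine Or.inr (Or.inl ⟨by simpa using h0, ?_⟩)
    ext <;> simp [foldSystem, hN]
  · refine Or.inl ⟨by simpa using h0, ?_⟩
    ext <;> simp [foldSystem, hP]
  · refine Or.inr (Or.inr ⟨by simp [h0], d, c, hd, hc, by linarith, ?_⟩)
    ext
    · simp [foldSystem]
    · simp only [foldSystem, hP, hN, Prod.snd_add, Prod.smul_snd, smul_eq_mul]; ring

theorem mem_slidingRegion_reversed (hP : ∀ t, P t = n (-t)) (hN : ∀ t, N t = p (-t))
    (t : ℝ) (z : ℝ × ℝ) : (t, z.1, -z.2) ∈ (foldSystem α P N).slidingRegion ↔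
      (-t, z) ∈ (foldSystem α p n).escapingRegion := by
  simp [slidingRegion, escapingRegion, switching, foldSystem, hP, hN, and_comm]

theorem mem_escapingRegion_reversed (hP : ∀ t, P t = n (-t)) (hN : ∀ t, N t = p (-t))
    (t : ℝ) (z : ℝ × ℝ) : (t, z.1, -z.2) ∈ (foldSystem α P N).escapingRegion ↔
      (-t, z) ∈ (foldSystem α p n).slidingRegion := by
  simp [slidingRegion, escapingRegion, switching, foldSystem, hP, hN, and_comm]

theorem slidingField_reversed (hP : ∀ t, P t = n (-t)) (hN : ∀ t, N t = p (-t))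
    (t : ℝ) (z : ℝ × ℝ) : (foldSystem α P N).slidingField t (z.1, -z.2) =
      (-((foldSystem α p n).slidingField (-t) z).1, ((foldSystem α p n).slidingField (-t) z).2) := by
  have e : ∀ b c : ℝ, (b - c)⁻¹ = -(c - b)⁻¹ := fun b c => by rw [← inv_neg, neg_sub]
  ext
  · simp only [slidingField, foldSystem, hP, hN, Prod.smul_fst, Prod.fst_sub, smul_eq_mul]
    rw [e]
    ring
  · simp only [slidingField, foldSystem, hP, hN, Prod.smul_snd, Prod.snd_sub, smul_eq_mul]
    rw [e]
    ring

theorem IsLipschitzSlidingSolution.reversed {T : ℝ}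
    (hP : ∀ t, P t = n (-t)) (hN : ∀ t, N t = p (-t))
    (h : (foldSystem α p n).IsLipschitzSlidingSolution T (foldSystem α p n).slidingRegion u) :
    (foldSystem α P N).IsLipschitzSlidingSolution T (foldSystem α P N).escapingRegion
      fun t => ((u (-t)).1, -(u (-t)).2) := by
  obtain ⟨h₁, h₂, ⟨b, c, hbc, h₃⟩, h₄⟩ := h
  refine ⟨IsLipschitzSolution.reversed hP hN h₁, fun t => ?_,
    ⟨-c, -b, by linarith, fun t ht => ?_⟩, fun t ht => ?_⟩
  · have e : u (-(t + T)) = u (-t) := by rw [← h₂ (-(t + T))]; congr 1; ring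
    simp only [e]
  · obtain ⟨k₁, k₂⟩ := h₃ (-t) ⟨by linarith [ht.2], by linarith [ht.1]⟩
    refine ⟨(mem_escapingRegion_reversed hP hN _ _).2 k₁, ?_⟩
    rw [slidingField_reversed hP hN]
    exact hasDerivAt_reversed k₂
  · refine (mem_escapingRegion_reversed hP hN _ _).2 (h₄ _ ?_)
    rcases ht with ht | ht
    · exact Or.inr ((mem_slidingRegion_reversed hP hN _ _).1 ht)
    · exact Or.inl ((mem_escapingRegion_reversed hP hN _ _).1 ht)

end Reversal

/-! ### Roots depending continuously on a parameter -/

/-- Monotonicity replaces the implicit function theorem: `g` is negative at a point just below the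
root, this persists for nearby parameters, and there it keeps the root above that point. The same
holds from above. -/
theorem exists_continuousOn_root {g : ℝ × ℝ → ℝ} {P : Set ℝ} {A B : ℝ} (hAB : A ≤ B)
    (hg : ContinuousOn g (P ×ˢ Icc A B))
    (hmono : ∀ p ∈ P, StrictMonoOn (fun s => g (p, s)) (Icc A B))
    (hA : ∀ p ∈ P, g (p, A) < 0) (hB : ∀ p ∈ P, 0 < g (p, B)) :
    ∃ r : ℝ → ℝ, ContinuousOn r P ∧ ∀ p ∈ P, r p ∈ Ioo A B ∧ g (p, r p) = 0 := by
  have hex : ∀ p ∈ P, ∃ s ∈ Ioo A B, g (p, s) = 0 := fun p hp => by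
    have hc : ContinuousOn (fun s => g (p, s)) (Icc A B) :=
      hg.comp (by fun_prop) fun s hs => ⟨hp, hs⟩
    exact intermediate_value_Ioo hAB hc ⟨hA p hp, hB p hp⟩
  choose! r hr hr0 using hex
  refine ⟨r, fun p hp => ?_, fun p hp => ⟨hr p hp, hr0 p hp⟩⟩
  have hsec : ∀ s ∈ Icc A B, ContinuousWithinAt (fun q => g (q, s)) P p := fun s hs =>
    (hg.comp (f := fun q => (q, s)) (by fun_prop) fun q hq => ⟨hq, hs⟩) p hp
  rw [ContinuousWithinAt, tendsto_order]
  constructor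
  · intro b hb
    have hm : max A b ∈ Icc A B := ⟨le_max_left _ _, max_le hAB (hb.le.trans (hr p hp).2.le)⟩
    have hneg : g (p, max A b) < 0 := by
      rw [← hr0 p hp]
      exact hmono p hp hm (Ioo_subset_Icc_self (hr p hp)) (max_lt (hr p hp).1 hb)
    filter_upwards [(hsec _ hm).eventually (gt_mem_nhds hneg), self_mem_nhdsWithin] with q hq hqP
    by_contra! hle
    have := (hmono q hqP).monotoneOn (Ioo_subset_Icc_self (hr q hqP)) hm
      (hle.trans (le_max_right _ _))
    simp only [hr0 q hqP] at this
    linarith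
  · intro b hb
    have hm : min B b ∈ Icc A B := ⟨le_min hAB ((hr p hp).1.le.trans hb.le), min_le_left _ _⟩
    have hpos : 0 < g (p, min B b) := by
      rw [← hr0 p hp]
      exact hmono p hp (Ioo_subset_Icc_self (hr p hp)) hm (lt_min (hr p hp).2 hb)
    filter_upwards [(hsec _ hm).eventually (lt_mem_nhds hpos), self_mem_nhdsWithin] with q hq hqP
    by_contra! hle
    have := (hmono q hqP).monotoneOn hm (Ioo_subset_Icc_self (hr q hqP))
      ((min_le_right _ _).trans hle)
    simp only [hr0 q hqP] at this
    linarith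

/-! ### The periodic forcing -/

/-- The forcing term, with period `6` and maximum at `0`. -/
noncomputable def forcing (t : ℝ) : ℝ := Real.cos (Real.pi * t / 3)

/-- The derivative of `forcing`. -/
noncomputable def forcingDeriv (t : ℝ) : ℝ := -(Real.pi / 3) * Real.sin (Real.pi * t / 3)

/-- The odd primitive of `forcing`. -/
noncomputable def forcingPrimitive (t : ℝ) : ℝ := Real.sin (Real.pi * t / 3) / (Real.pi / 3)

theorem hasDerivAt_forcing (t : ℝ) : HasDerivAt forcing (forcingDeriv t) t := by
  have h : HasDerivAt (fun t : ℝ => Real.pi * t / 3) (Real.pi * 1 / 3) t :=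
    ((hasDerivAt_id t).const_mul _).div_const _
  refine h.cos.congr_deriv ?_
  rw [forcingDeriv]; ring

theorem hasDerivAt_forcingPrimitive (t : ℝ) :
    HasDerivAt forcingPrimitive (forcing t) t := by
  have h : HasDerivAt (fun t : ℝ => Real.pi * t / 3) (Real.pi * 1 / 3) t :=
    ((hasDerivAt_id t).const_mul _).div_const _
  refine (h.sin.div_const (Real.pi / 3)).congr_deriv ?_
  have := Real.pi_ne_zero
  rw [forcing]; field_simp

@[fun_prop]
theorem contDiff_forcing : ContDiff ℝ 1 forcing := by unfold forcing; fun_prop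

@[fun_prop]
theorem contDiff_forcingPrimitive : ContDiff ℝ 1 forcingPrimitive := by
  unfold forcingPrimitive; fun_prop

@[fun_prop]
theorem continuous_forcing : Continuous forcing := contDiff_forcing.continuous

@[fun_prop]
theorem continuous_forcingPrimitive : Continuous forcingPrimitive :=
  contDiff_forcingPrimitive.continuous

theorem forcing_add_three (t : ℝ) : forcing (t + 3) = -forcing t := by
  rw [forcing, forcing, ← Real.cos_add_pi]; congr 1; ring

theorem forcingPrimitive_add_three (t : ℝ) :
    forcingPrimitive (t + 3) = -forcingPrimitive t := by
  rw [forcingPrimitive, forcingPrimitive, ← neg_div, ← Real.sin_add_pi]; congr 2; ring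

theorem forcing_add_six (t : ℝ) : forcing (t + 6) = forcing t := by
  rw [show t + 6 = t + 3 + 3 by ring, forcing_add_three, forcing_add_three, neg_neg]

theorem forcingPrimitive_add_six (t : ℝ) : forcingPrimitive (t + 6) = forcingPrimitive t := by
  rw [show t + 6 = t + 3 + 3 by ring, forcingPrimitive_add_three, forcingPrimitive_add_three,
    neg_neg]

theorem forcingPrimitive_zero : forcingPrimitive 0 = 0 := by simp [forcingPrimitive]

theorem forcing_zero : forcing 0 = 1 := by simp [forcing]

theorem forcing_neg (t : ℝ) : forcing (-t) = forcing t := by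
  rw [forcing, forcing, ← Real.cos_neg]; congr 1; ring

theorem forcingPrimitive_neg (t : ℝ) : forcingPrimitive (-t) = -forcingPrimitive t := by
  rw [forcingPrimitive, forcingPrimitive, ← neg_div, ← Real.sin_neg]; congr 2; ring

theorem abs_forcing_le (t : ℝ) : |forcing t| ≤ 1 := Real.abs_cos_le_one _

theorem abs_forcingDeriv_le (t : ℝ) : |forcingDeriv t| ≤ 2 := by
  rw [forcingDeriv, abs_mul, abs_neg, abs_of_pos (by positivity)]
  have h := Real.abs_sin_le_one (Real.pi * t / 3)
  have := Real.pi_le_four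
  have := Real.pi_pos
  nlinarith [abs_nonneg (Real.sin (Real.pi * t / 3))]

theorem abs_sub_le_of_hasDerivAt {f f' : ℝ → ℝ} {C a b : ℝ} (h : ∀ t, HasDerivAt f (f' t) t)
    (hb : ∀ t ∈ uIcc a b, |f' t| ≤ C) : |f b - f a| ≤ C * |b - a| :=
  (convex_uIcc a b).norm_image_sub_le_of_norm_hasDerivWithin_le
    (fun t _ => (h t).hasDerivWithinAt) hb left_mem_uIcc right_mem_uIcc

theorem abs_forcing_sub_le (a b : ℝ) : |forcing b - forcing a| ≤ 2 * |b - a| :=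
  abs_sub_le_of_hasDerivAt hasDerivAt_forcing fun t _ => abs_forcingDeriv_le t

theorem abs_forcingPrimitive_sub_le (a b : ℝ) :
    |forcingPrimitive b - forcingPrimitive a| ≤ |b - a| := by
  simpa using abs_sub_le_of_hasDerivAt hasDerivAt_forcingPrimitive fun t _ => abs_forcing_le t

/-- A Taylor bound of second order, needed where an arc is tangent to the line and its linear term
vanishes or has a known sign. -/
theorem abs_forcingPrimitive_sub_sub_le (a b : ℝ) :
    |forcingPrimitive b - forcingPrimitive a - forcing a * (b - a)| ≤ 2 * (b - a) ^ 2 := by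
  have hd : ∀ t, HasDerivAt (fun t => forcingPrimitive t - forcing a * t)
      (forcing t - forcing a) t := fun t =>
    ((hasDerivAt_forcingPrimitive t).sub ((hasDerivAt_id t).const_mul (forcing a))).congr_deriv
      (by ring)
  have := abs_sub_le_of_hasDerivAt (a := a) (b := b) (C := 2 * |b - a|) hd fun t ht =>
    (abs_forcing_sub_le a t).trans (mul_le_mul_of_nonneg_left (abs_sub_left_of_mem_uIcc ht) zero_le_two)
  rw [mul_assoc, abs_mul_abs_self, ← sq] at this
  refine le_of_eq_of_le (congrArg _ ?_) this
  ring

theorem forcing_ge {t : ℝ} (ht : |t| ≤ 1 / 100) : 49 / 50 ≤ forcing t := by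
  have h := abs_le.1 (abs_forcing_sub_le 0 t)
  rw [forcing_zero, sub_zero] at h
  linarith [h.1]

theorem half_le_forcingPrimitive {t : ℝ} (h0 : 0 ≤ t) (ht : t ≤ 1 / 4) :
    t / 2 ≤ forcingPrimitive t := by
  have h := abs_le.1 (abs_forcingPrimitive_sub_sub_le 0 t)
  rw [forcing_zero, forcingPrimitive_zero, sub_zero, sub_zero] at h
  nlinarith [h.1]

/-! ### Backward flow of a scalar equation -/

/-- Time is adjoined as a second coordinate with velocity `-1`. The equation becomes autonomous, and
Picard–Lindelöf gives continuity jointly in the initial point, the initial time and the elapsed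
time. -/
theorem exists_backward_flow {g : ℝ × ℝ → ℝ} {K : NNReal} {c : ℝ × ℝ}
    (hg : LipschitzOnWith K g (Metric.closedBall c (1 / 2))) (hb : ∀ z, |g z| ≤ 1) :
    ∃ X : (ℝ × ℝ) × ℝ → ℝ,
      (∀ z ∈ Metric.closedBall c (1 / 4), X (z, 0) = z.1 ∧ ∀ r ∈ Icc (0 : ℝ) (1 / 4),
        HasDerivWithinAt (fun r => X (z, r)) (-g (X (z, r), z.2 - r)) (Icc 0 (1 / 4)) r) ∧
      ContinuousOn X (Metric.closedBall c (1 / 4) ×ˢ Icc 0 (1 / 4)) := by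
  have hf : LipschitzOnWith (max K 0) (fun z => (-g z, (-1 : ℝ)))
      (Metric.closedBall c (1 / 2)) :=
    (LipschitzOnWith.of_dist_le_mul fun x hx y hy => by
      simpa [dist_neg_neg] using hg.dist_le_mul x hx y hy).prodMk
      (LipschitzWith.const (-1 : ℝ)).lipschitzOnWith
  have hPL : IsPicardLindelof (fun _ : ℝ => fun z : ℝ × ℝ => (-g z, (-1 : ℝ)))
      (tmin := 0) (tmax := 1 / 4) ⟨0, by norm_num, by norm_num⟩ c (1 / 2) (1 / 4) 1 (max K 0) := by
    refine IsPicardLindelof.of_time_independent (fun z _ => ?_) (by simpa using hf) ?_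
    · simp [Prod.norm_def, hb z]
    · norm_num
  obtain ⟨φ, hφ, hcont⟩ := hPL.exists_forall_mem_closedBall_eq_hasDerivWithinAt_continuousOn
  have hq : ((1 / 4 : NNReal) : ℝ) = 1 / 4 := by norm_num
  rw [hq] at hφ hcont
  refine ⟨fun w => (φ w).1, fun z hz => ⟨congrArg Prod.fst (hφ z hz).1, fun r hr => ?_⟩,
    continuous_fst.comp_continuousOn hcont⟩
  obtain ⟨h0, hd⟩ := hφ z hz
  have hsnd : ∀ r ∈ Icc (0 : ℝ) (1 / 4), (φ (z, r)).2 = z.2 - r := by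
    have hdiff : ∀ r ∈ Icc (0 : ℝ) (1 / 4),
        HasDerivWithinAt (fun r => (φ (z, r)).2 + r) 0 (Icc 0 (1 / 4)) r := fun r hr => by
      exact ((hd r hr).hasFDerivWithinAt.snd.hasDerivWithinAt.add
        (hasDerivWithinAt_id r _)).congr_deriv (by simp)
    intro r hr
    have := (convex_Icc (0 : ℝ) (1 / 4)).norm_image_sub_le_of_norm_hasDerivWithin_le (C := 0)
      hdiff (by simp) (left_mem_Icc.2 (by norm_num)) hr
    simp only [zero_mul, norm_le_zero_iff, h0, add_zero] at this
    linarith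
  have := (hd r hr).hasFDerivWithinAt.fst.hasDerivWithinAt
  rw [← hsnd r hr]
  simpa using this

/-! ### Sliding arcs ending at a fold -/

/-- The speed of the sliding motion at `(x, t)`, truncated to `[-1, 1]`. -/
noncomputable def slideSpeed (ε lam : ℝ) (z : ℝ × ℝ) : ℝ :=
  max (-1) (min 1 (-1 + 2 * (z.1 ^ 2 - 1 + ε * forcing z.2) / (ε * (1 - lam) * forcing z.2)))

theorem abs_slideSpeed_le (ε lam : ℝ) (z : ℝ × ℝ) : |slideSpeed ε lam z| ≤ 1 :=
  abs_le.2 ⟨le_max_left _ _, max_le (by norm_num) (min_le_left _ _)⟩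

/-- On this ball `|t| ≤ 1/2`, so `forcing` is positive and the quotient is C¹, hence Lipschitz by
compactness. Truncation is 1-Lipschitz. -/
theorem exists_lipschitzOnWith_slideSpeed {ε lam : ℝ} (hε : 0 < ε) (hl : lam < 1) :
    ∃ K, LipschitzOnWith K (slideSpeed ε lam) (Metric.closedBall (1, 0) (1 / 2)) := by
  set f : ℝ × ℝ → ℝ := fun z =>
    -1 + 2 * (z.1 ^ 2 - 1 + ε * forcing z.2) / (ε * (1 - lam) * forcing z.2)
  have hloc : LocallyLipschitzOn (Metric.closedBall ((1 : ℝ), (0 : ℝ)) (1 / 2)) f := by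
    intro z hz
    have hz2 : |z.2| ≤ 1 / 2 := by
      have := (Prod.dist_eq (x := z) (y := ((1 : ℝ), (0 : ℝ)))) ▸ Metric.mem_closedBall.1 hz
      simpa [Real.dist_eq] using (le_max_right _ _).trans this
    have hpos : 0 < forcing z.2 := by
      rw [abs_le] at hz2
      refine Real.cos_pos_of_mem_Ioo ⟨?_, ?_⟩ <;> nlinarith [Real.pi_pos]
    have hne : ε * (1 - lam) * forcing z.2 ≠ 0 :=
      (mul_pos (mul_pos hε (sub_pos.2 hl)) hpos).ne'
    have hc : ContDiffAt ℝ 1 f z := by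
      have h₁ : ContDiffAt ℝ 1 (fun z : ℝ × ℝ => forcing z.2) z := by fun_prop
      refine contDiffAt_const.add (ContDiffAt.div ?_ (contDiffAt_const.mul h₁) hne)
      fun_prop
    obtain ⟨K, t, ht, hK⟩ := hc.exists_lipschitzOnWith
    exact ⟨K, t, mem_nhdsWithin_of_mem_nhds ht, hK⟩
  obtain ⟨K, hK⟩ := hloc.exists_lipschitzOnWith_of_compact (isCompact_closedBall _ _)
  have hclamp : LipschitzWith 1 fun y : ℝ => max (-1) (min 1 y) :=
    (LipschitzWith.id.const_min 1).const_max (-1)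
  exact ⟨1 * K, hclamp.comp_lipschitzOnWith hK⟩

section Barrier

variable {ε lam s : ℝ} {X : ℝ → ℝ}

/-- A barrier argument in backward time `r` for `W = X² - 1 + ε * forcing`, the vertical component
of the lower field. At `W = 0` the speed is `-1` and `W` increases at rate about 2. At `3/4` of the
width `ε * (1 - lam) * forcing` of the sliding strip the speed is `1/2` and `W` decreases at rate
about 1. Both rates dominate the `O(ε)` drift of the barriers. -/
theorem slidingArc_bounds (hε : 0 < ε) (hl : lam < 1) (hεl : ε * (1 + |lam|) ≤ 1 / 100000)
    (hs : |s| ≤ 1 / 1000) (hX0 : |X 0 - 1| ≤ ε) (hW0 : X 0 ^ 2 - 1 + ε * forcing s = 0)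
    (hX : ∀ r ∈ Icc (0 : ℝ) (1 / 4),
      HasDerivWithinAt X (-slideSpeed ε lam (X r, s - r)) (Icc 0 (1 / 4)) r) :
    ∀ r ∈ Icc 0 (40 * ε), |X r - X 0| ≤ r ∧
      0 ≤ X r ^ 2 - 1 + ε * forcing (s - r) ∧
      X r ^ 2 - 1 + ε * forcing (s - r) ≤ 3 / 4 * (ε * (1 - lam) * forcing (s - r)) ∧
      (0 < r → 0 < X r ^ 2 - 1 + ε * forcing (s - r)) := by
  have hε1 : ε ≤ 1 / 100000 := by nlinarith [abs_nonneg lam]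
  have h40 : 40 * ε ≤ 1 / 1000 := by linarith
  have hsub : ∀ r ∈ Icc 0 (40 * ε), r ∈ Icc (0 : ℝ) (1 / 4) := fun r hr =>
    ⟨hr.1, hr.2.trans (by linarith)⟩
  have hfor : ∀ r ∈ Icc 0 (40 * ε), 49 / 50 ≤ forcing (s - r) := fun r hr => by
    refine forcing_ge ?_
    rw [abs_le] at hs ⊢
    constructor <;> linarith [hs.1, hs.2, hr.1, hr.2]
  have hlip : ∀ r ∈ Icc 0 (40 * ε), |X r - X 0| ≤ r := fun r hr => by
    have := (convex_Icc (0 : ℝ) (1 / 4)).norm_image_sub_le_of_norm_hasDerivWithin_le (C := 1) hX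
      (fun r _ => by rw [norm_neg]; exact abs_slideSpeed_le _ _ _)
      (left_mem_Icc.2 (by norm_num)) (hsub r hr)
    simpa [abs_of_nonneg hr.1] using this
  have hXge : ∀ r ∈ Icc 0 (40 * ε), 99 / 100 ≤ X r := fun r hr => by
    have h₁ := abs_le.1 (hlip r hr)
    have h₂ := abs_le.1 hX0
    linarith [h₁.1, h₂.1, hr.2]
  set W : ℝ → ℝ := fun r => X r ^ 2 - 1 + ε * forcing (s - r) with hWdef
  set W' : ℝ → ℝ := fun r =>
    2 * X r * -slideSpeed ε lam (X r, s - r) - ε * forcingDeriv (s - r) with hW'def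
  have hF : ∀ r, HasDerivAt (fun r => forcing (s - r)) (-forcingDeriv (s - r)) r := fun r =>
    HasDerivAt.comp_const_sub s r (hasDerivAt_forcing (s - r))
  have hW : ∀ r ∈ Icc 0 (40 * ε), HasDerivWithinAt W (W' r) (Icc 0 (40 * ε)) r := fun r hr => by
    have h₁ := (hX r (hsub r hr)).mono hsub
    refine (((h₁.pow 2).sub_const 1).add ((hF r).hasDerivWithinAt.const_mul ε)).congr_deriv ?_
    simp only [hW'def]; norm_num; ring
  have hWr : ∀ r ∈ Ico 0 (40 * ε), HasDerivWithinAt W (W' r) (Ici r) r := fun r hr =>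
    (hW r ⟨hr.1, hr.2.le⟩).mono_of_mem_nhdsWithin (Icc_mem_nhdsGE_of_mem hr)
  have hWc : ContinuousOn W (Icc 0 (40 * ε)) := fun r hr => (hW r hr).continuousWithinAt
  have hder : ∀ r, |ε * forcingDeriv (s - r)| ≤ 2 * ε := fun r => by
    rw [abs_mul, abs_of_pos hε, mul_comm]
    exact mul_le_mul_of_nonneg_right (abs_forcingDeriv_le _) hε.le
  have hzero : ∀ r ∈ Icc 0 (40 * ε), W r = 0 → 0 < W' r := fun r hr h0 => by
    have : slideSpeed ε lam (X r, s - r) = -1 := by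
      simp only [hWdef] at h0
      simp [slideSpeed, h0]
    simp only [hW'def, this]
    linarith [hXge r hr, (abs_le.1 (hder r)).2]
  have hnonneg : ∀ r ∈ Icc 0 (40 * ε), 0 ≤ W r := by
    intro r hr
    refine image_le_of_deriv_right_lt_deriv_boundary' (f := fun _ => 0) (f' := fun _ => 0)
      continuousOn_const (fun x _ => hasDerivWithinAt_const _ _ _) ?_ hWc hWr
      (fun x hx h => hzero x ⟨hx.1, hx.2.le⟩ h.symm) hr
    simp [hWdef, hW0]
  refine fun r hr => ⟨hlip r hr, hnonneg r hr, ?_, fun hr0 => ?_⟩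
  · refine image_le_of_deriv_right_lt_deriv_boundary' hWc hWr
      (B := fun r => 3 / 4 * (ε * (1 - lam) * forcing (s - r)))
      (B' := fun r => 3 / 4 * (ε * (1 - lam) * -forcingDeriv (s - r))) ?_
      (by fun_prop) (fun x _ => (((hF x).const_mul _).const_mul _).hasDerivWithinAt) ?_ hr
    · have := hfor 0 ⟨le_rfl, by positivity⟩
      simp only [hWdef, sub_zero, hW0] at this ⊢
      have := mul_pos hε (sub_pos.2 hl)
      positivity
    · intro x hx hWx
      have hx' : x ∈ Icc 0 (40 * ε) := ⟨hx.1, hx.2.le⟩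
      have hD : 0 < ε * (1 - lam) * forcing (s - x) :=
        mul_pos (mul_pos hε (sub_pos.2 hl)) (by linarith [hfor x hx'])
      have : slideSpeed ε lam (X x, s - x) = 1 / 2 := by
        simp only [hWdef] at hWx
        simp only [slideSpeed]
        rw [hWx, mul_div_assoc, mul_div_assoc, div_self hD.ne']
        norm_num
      simp only [hW'def, this]
      have h₁ := abs_le.1 (hder x)
      have h₂ : |(1 - lam) * (ε * forcingDeriv (s - x))| ≤ (1 + |lam|) * (2 * ε) := by
        rw [abs_mul]
        refine mul_le_mul ?_ (hder x) (abs_nonneg _) (by positivity)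
        simpa using abs_sub (1 : ℝ) lam
      have h₃ := (abs_le.1 h₂).2
      nlinarith [hXge x hx', h₁.1]
  -- A zero of `W` at some `r > 0` would be a minimum from the left, forcing `W' r ≤ 0`, against
  -- `hzero`.
  · refine lt_of_le_of_ne (hnonneg r hr) fun h0 => ?_
    have hpos := hzero r hr h0.symm
    have hd := (hW r hr).mono (Icc_subset_Icc_right hr.2)
    have hle : W' r ≤ 0 := by
      have hd' : HasDerivWithinAt W (W' r) (Iio r) r :=
        (hd.mono_of_mem_nhdsWithin (Icc_mem_nhdsLT hr0))
      rw [hasDerivWithinAt_iff_tendsto_slope' (by simp)] at hd'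
      refine le_of_tendsto hd' ?_
      filter_upwards [Ioo_mem_nhdsLT hr0] with q hq
      rw [slope_def_field]
      refine div_nonpos_of_nonneg_of_nonpos ?_ (by linarith [hq.2])
      linarith [hnonneg q ⟨hq.1.le, hq.2.le.trans hr.2⟩, h0]
    linarith

end Barrier

/-! ### Matching the arcs -/

/-- The abscissa of the fold of the lower field at time `s`. -/
noncomputable def foldX (ε s : ℝ) : ℝ := √(1 - ε * forcing s)

/-- The height, after time `q`, of the lower arc leaving the fold at time `s`. -/
noncomputable def lowerHeight (ε : ℝ) (z : ℝ × ℝ) : ℝ :=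
  z.2 ^ 2 * (z.2 / 3 - foldX ε z.1) +
    ε * (forcingPrimitive (z.1 + z.2) - forcingPrimitive z.1 - forcing z.1 * z.2)

/-- The primitive of `x² - 1`. -/
noncomputable def cubic (x : ℝ) : ℝ := x ^ 3 / 3 - x

@[fun_prop]
theorem continuous_foldX (ε : ℝ) : Continuous (foldX ε) := by unfold foldX; fun_prop

@[fun_prop]
theorem continuous_lowerHeight (ε : ℝ) : Continuous (lowerHeight ε) := by
  unfold lowerHeight; fun_prop

@[fun_prop]
theorem continuous_cubic : Continuous cubic := by unfold cubic; fun_prop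

/-! ### The lower arc and its duration -/

section

variable {ε s : ℝ}

theorem foldX_sq (hε : 0 < ε) (hε1 : ε ≤ 1 / 100000) (s : ℝ) :
    foldX ε s ^ 2 = 1 - ε * forcing s :=
  Real.sq_sqrt (by nlinarith [(abs_le.1 (abs_forcing_le s)).2])

theorem foldX_bounds (hε : 0 < ε) (hε1 : ε ≤ 1 / 100000) (hs : |s| ≤ 1 / 1000) :
    1 - ε ≤ foldX ε s ∧ foldX ε s ≤ 1 ∧ ε * forcing s / 2 ≤ 1 - foldX ε s := by
  have h₁ := foldX_sq hε hε1 s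
  have h₂ : 0 ≤ foldX ε s := Real.sqrt_nonneg _
  have h₃ := forcing_ge (hs.trans (by norm_num))
  have h₄ := (abs_le.1 (abs_forcing_le s)).2
  have h₅ : foldX ε s ≤ 1 := by nlinarith
  refine ⟨?_, h₅, ?_⟩ <;> nlinarith

theorem lowerHeight_eq (hε : 0 < ε) (hε1 : ε ≤ 1 / 100000) (s q : ℝ) :
    lowerHeight ε (s, q) = -(cubic (foldX ε s - q) - cubic (foldX ε s)) +
      ε * (forcingPrimitive (s + q) - forcingPrimitive s) := by
  have h := foldX_sq hε hε1 s
  simp only [lowerHeight, cubic]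
  linear_combination (-q) * h

theorem hasDerivAt_lowerHeight (hε : 0 < ε) (hε1 : ε ≤ 1 / 100000) (s q : ℝ) :
    HasDerivAt (fun q => lowerHeight ε (s, q))
      ((foldX ε s - q) ^ 2 - 1 + ε * forcing (s + q)) q := by
  have h₁ : HasDerivAt (fun q : ℝ => q ^ 2 * (q / 3 - foldX ε s))
      (2 * q * (q / 3 - foldX ε s) + q ^ 2 * (1 / 3)) q := by
    exact (((hasDerivAt_id q).pow 2).mul
      (((hasDerivAt_id q).div_const 3).sub_const (foldX ε s))).congr_deriv (by simp)
  have h₂ : HasDerivAt (fun q => forcingPrimitive (s + q)) (forcing (s + q)) q :=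
    HasDerivAt.comp_const_add s q (hasDerivAt_forcingPrimitive (s + q))
  refine (h₁.add (((h₂.sub_const (forcingPrimitive s)).sub
    ((hasDerivAt_id q).const_mul (forcing s))).const_mul ε)).congr_deriv ?_
  linear_combination -foldX_sq hε hε1 s

/-- On this range the abscissa `foldX ε s - q` is at most `-8/5`, where `x² - 1` dominates the
forcing. -/
theorem strictMonoOn_lowerHeight (hε : 0 < ε) (hε1 : ε ≤ 1 / 100000) (hs : |s| ≤ 1 / 1000) :
    StrictMonoOn (fun q => lowerHeight ε (s, q)) (Icc (13 / 5) 3) := by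
  refine strictMonoOn_of_hasDerivWithinAt_pos (convex_Icc _ _) (by fun_prop)
    (fun q _ => (hasDerivAt_lowerHeight hε hε1 s q).hasDerivWithinAt) fun q hq => ?_
  rw [interior_Icc] at hq
  have h₁ := foldX_bounds hε hε1 hs
  have h₂ := (abs_le.1 (abs_forcing_le (s + q))).1
  nlinarith [hq.1]

theorem abs_lowerHeight_sub_le (hε : 0 < ε) (s q : ℝ) :
    |lowerHeight ε (s, q) - q ^ 2 * (q / 3 - foldX ε s)| ≤ 2 * ε * q ^ 2 := by
  have h := abs_forcingPrimitive_sub_sub_le s (s + q)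
  simp only [lowerHeight, add_sub_cancel_left, abs_mul, abs_of_pos hε] at h ⊢
  nlinarith

/-- Departure from the fold makes the height quadratic in `q`, so a single factor decides its sign
down to `q = 0`. -/
theorem lowerHeight_neg (hε : 0 < ε) (hε1 : ε ≤ 1 / 100000) (hs : |s| ≤ 1 / 1000) {q : ℝ}
    (h0 : 0 < q) (hq : q ≤ 13 / 5) : lowerHeight ε (s, q) < 0 := by
  have h₁ := foldX_bounds hε hε1 hs
  have h₂ := (abs_le.1 (abs_lowerHeight_sub_le hε s q)).2
  have h₃ : q ^ 2 * (q / 3 - foldX ε s + 2 * ε) < 0 :=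
    mul_neg_of_pos_of_neg (by positivity) (by linarith)
  linarith

/-- At `q = 3` the displaced fold contributes `9 * (1 - foldX ε s)`, at least `9/2 * ε * forcing s`,
which beats the term `-3 * ε * forcing s`. This makes the lower arc last less than 3 and leaves room
for sliding. -/
theorem lowerHeight_three_pos (hε : 0 < ε) (hε1 : ε ≤ 1 / 100000) (hs : |s| ≤ 1 / 1000) :
    0 < lowerHeight ε (s, 3) := by
  have h₁ := foldX_bounds hε hε1 hs
  have h₂ := forcing_ge (hs.trans (by norm_num))
  have h₃ := abs_le.1 (abs_forcingPrimitive_sub_le 0 s)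
  rw [forcingPrimitive_zero, sub_zero, sub_zero] at h₃
  have h₄ : 0 < ε * (3 / 2 * forcing s - 2 * forcingPrimitive s) :=
    mul_pos hε (by linarith [h₃.2])
  simp only [lowerHeight, forcingPrimitive_add_three]
  linarith

theorem exists_lower_duration (hε : 0 < ε) (hε1 : ε ≤ 1 / 100000) :
    ∃ q : ℝ → ℝ, ContinuousOn q (Icc (-(1 / 1000)) (1 / 1000)) ∧
      ∀ s ∈ Icc (-(1 / 1000) : ℝ) (1 / 1000),
        q s < 3 ∧ 3 - 9 * ε ≤ q s ∧ lowerHeight ε (s, q s) = 0 := by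
  obtain ⟨q, hq, h⟩ := exists_continuousOn_root (g := lowerHeight ε)
    (P := Icc (-(1 / 1000)) (1 / 1000)) (A := 13 / 5) (B := 3) (by norm_num) (by fun_prop)
    (fun s hs => strictMonoOn_lowerHeight hε hε1 (abs_le.2 hs))
    (fun s hs => lowerHeight_neg hε hε1 (abs_le.2 hs) (by norm_num) le_rfl)
    (fun s hs => lowerHeight_three_pos hε hε1 (abs_le.2 hs))
  refine ⟨q, hq, fun s hs => ⟨(h s hs).1.2, ?_, (h s hs).2⟩⟩
  have h₁ := foldX_bounds hε hε1 (abs_le.2 hs)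
  have h₂ := (abs_le.1 (abs_lowerHeight_sub_le hε s (q s))).2
  rw [(h s hs).2] at h₂
  have hq0 := (h s hs).1.1
  by_contra! hlt
  have h₃ : q s ^ 2 * (q s / 3 - foldX ε s + 2 * ε) < 0 :=
    mul_neg_of_pos_of_neg (by positivity) (by linarith)
  linarith

end

/-- The data of a sliding arc that ends on the fold of the lower field at time `s`. -/
def IsSlidingArc (ε lam s : ℝ) (X : ℝ → ℝ) : Prop :=
  X 0 = foldX ε s ∧ ∀ r ∈ Icc (0 : ℝ) (1 / 4),
    HasDerivWithinAt X (-slideSpeed ε lam (X r, s - r)) (Icc 0 (1 / 4)) r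

/-! ### A priori bounds along a sliding arc -/

section

variable {ε lam s : ℝ} {X : ℝ → ℝ}

theorem IsSlidingArc.bounds (hX : IsSlidingArc ε lam s X) (hε : 0 < ε) (hl : lam < 1)
    (hεl : ε * (1 + |lam|) ≤ 1 / 100000) (hs : |s| ≤ 1 / 1000) :
    ∀ r ∈ Icc 0 (40 * ε), |X r - foldX ε s| ≤ r ∧
      0 ≤ X r ^ 2 - 1 + ε * forcing (s - r) ∧
      X r ^ 2 - 1 + ε * forcing (s - r) ≤ 3 / 4 * (ε * (1 - lam) * forcing (s - r)) ∧
      (0 < r → 0 < X r ^ 2 - 1 + ε * forcing (s - r)) := by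
  have hε1 : ε ≤ 1 / 100000 := by nlinarith [abs_nonneg lam]
  rw [← hX.1]
  have hb := foldX_bounds hε hε1 hs
  refine slidingArc_bounds hε hl hεl hs ?_ ?_ hX.2
  · rw [hX.1, abs_le]; constructor <;> linarith
  · rw [hX.1, foldX_sq hε hε1]; ring

theorem IsSlidingArc.slideSpeed_eq (hX : IsSlidingArc ε lam s X) (hε : 0 < ε) (hl : lam < 1)
    (hεl : ε * (1 + |lam|) ≤ 1 / 100000) (hs : |s| ≤ 1 / 1000) :
    ∀ r ∈ Icc 0 (40 * ε), slideSpeed ε lam (X r, s - r) =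
        -1 + 2 * (X r ^ 2 - 1 + ε * forcing (s - r)) / (ε * (1 - lam) * forcing (s - r)) ∧
      slideSpeed ε lam (X r, s - r) ≤ 1 / 2 := by
  intro r hr
  have hε1 : ε ≤ 1 / 100000 := by nlinarith [abs_nonneg lam]
  obtain ⟨-, h₀, h₁, -⟩ := hX.bounds hε hl hεl hs r hr
  have hf : 49 / 50 ≤ forcing (s - r) := by
    refine forcing_ge ?_
    rw [abs_le] at hs ⊢
    constructor <;> linarith [hs.1, hs.2, hr.1, hr.2]
  have hD : 0 < ε * (1 - lam) * forcing (s - r) :=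
    mul_pos (mul_pos hε (sub_pos.2 hl)) (by linarith)
  -- The bounds on `W` put the untruncated speed between `-1` and `1/2`, so the truncation is
  -- inactive.
  have h₂ : 2 * (X r ^ 2 - 1 + ε * forcing (s - r)) / (ε * (1 - lam) * forcing (s - r)) ≤ 3 / 2 := by
    rw [div_le_iff₀ hD]; linarith
  have h₃ : 0 ≤ 2 * (X r ^ 2 - 1 + ε * forcing (s - r)) / (ε * (1 - lam) * forcing (s - r)) :=
    div_nonneg (by linarith) hD.le
  have he : slideSpeed ε lam (X r, s - r) =
      -1 + 2 * (X r ^ 2 - 1 + ε * forcing (s - r)) / (ε * (1 - lam) * forcing (s - r)) := by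
    simp only [slideSpeed]
    rw [min_eq_right (by linarith), max_eq_right (by linarith)]
  exact ⟨he, by rw [he]; linarith⟩

theorem IsSlidingArc.monotoneOn (hX : IsSlidingArc ε lam s X) (hε : 0 < ε) (hl : lam < 1)
    (hεl : ε * (1 + |lam|) ≤ 1 / 100000) (hs : |s| ≤ 1 / 1000) :
    MonotoneOn (fun r => X r + r / 2) (Icc 0 (40 * ε)) := by
  have hε1 : ε ≤ 1 / 100000 := by nlinarith [abs_nonneg lam]
  have hsub : Icc 0 (40 * ε) ⊆ Icc (0 : ℝ) (1 / 4) := Icc_subset_Icc_right (by linarith)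
  have hd : ∀ r ∈ Icc 0 (40 * ε), HasDerivWithinAt (fun r => X r + r / 2)
      (-slideSpeed ε lam (X r, s - r) + 1 / 2) (Icc 0 (40 * ε)) r := fun r hr =>
    ((hX.2 r (hsub hr)).mono hsub).add ((hasDerivWithinAt_id r _).div_const 2)
  refine monotoneOn_of_hasDerivWithinAt_nonneg (convex_Icc _ _)
    (fun r hr => (hd r hr).continuousWithinAt)
    (fun r hr => (hd r (interior_subset hr)).mono interior_subset) fun r hr => ?_
  linarith [(hX.slideSpeed_eq hε hl hεl hs r (interior_subset hr)).2]

end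

theorem exists_slidingArc_family {ε lam : ℝ} (hε : 0 < ε) (hε1 : ε ≤ 1 / 100000) (hl : lam < 1) :
    ∃ X : ℝ × ℝ → ℝ, (∀ s ∈ Icc (-(1 / 1000) : ℝ) (1 / 1000), IsSlidingArc ε lam s
      fun r => X (s, r)) ∧
      ContinuousOn X (Icc (-(1 / 1000)) (1 / 1000) ×ˢ Icc 0 (1 / 4)) := by
  obtain ⟨K, hK⟩ := exists_lipschitzOnWith_slideSpeed hε hl
  obtain ⟨X, hX, hc⟩ := exists_backward_flow hK (abs_slideSpeed_le ε lam)
  have hmem : ∀ s ∈ Icc (-(1 / 1000) : ℝ) (1 / 1000),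
      (foldX ε s, s) ∈ Metric.closedBall ((1 : ℝ), (0 : ℝ)) (1 / 4) := fun s hs => by
    have hb := foldX_bounds hε hε1 (abs_le.2 hs)
    rw [Metric.mem_closedBall, Prod.dist_eq, Real.dist_eq, Real.dist_eq, sub_zero]
    refine max_le (abs_le.2 ⟨by linarith, by linarith⟩) ((abs_le.2 hs).trans (by norm_num))
  refine ⟨fun w => X ((foldX ε w.1, w.1), w.2), fun s hs => hX _ (hmem s hs), ?_⟩
  exact hc.comp (by fun_prop) fun w hw => ⟨hmem _ hw.1, hw.2⟩

/-- The gap `X (s, r) + r - foldX ε s - (6 - 2 * q s)` has slope at least `1/2` in `r`. It is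
negative at `r = 0` since `q s < 3`, and positive at `40 * ε` since it has gained at least `20 * ε`
while `6 - 2 * q s ≤ 18 * ε`. -/
theorem exists_landing {ε lam : ℝ} (hε : 0 < ε) (hl : lam < 1)
    (hεl : ε * (1 + |lam|) ≤ 1 / 100000) :
    ∃ (q d : ℝ → ℝ) (X : ℝ × ℝ → ℝ), ContinuousOn q (Icc (-(1 / 1000)) (1 / 1000)) ∧
      ContinuousOn d (Icc (-(1 / 1000)) (1 / 1000)) ∧
      ∀ s ∈ Icc (-(1 / 1000) : ℝ) (1 / 1000),
        (q s < 3 ∧ 3 - 9 * ε ≤ q s ∧ lowerHeight ε (s, q s) = 0) ∧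
        IsSlidingArc ε lam s (fun r => X (s, r)) ∧ d s ∈ Ioo 0 (40 * ε) ∧
        X (s, d s) = foldX ε s + 6 - 2 * q s - d s := by
  have hε1 : ε ≤ 1 / 100000 := by nlinarith [abs_nonneg lam]
  obtain ⟨q, hqc, hq⟩ := exists_lower_duration hε hε1
  obtain ⟨X, hX, hXc⟩ := exists_slidingArc_family hε hε1 hl
  have hmono : ∀ s ∈ Icc (-(1 / 1000) : ℝ) (1 / 1000),
      MonotoneOn (fun r => X (s, r) + r / 2) (Icc 0 (40 * ε)) := fun s hs =>
    (hX s hs).monotoneOn hε hl hεl (abs_le.2 hs)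
  have h0 : (0 : ℝ) ∈ Icc 0 (40 * ε) := ⟨le_rfl, by positivity⟩
  have h40 : 40 * ε ∈ Icc 0 (40 * ε) := ⟨by positivity, le_rfl⟩
  have hcont : ContinuousOn (fun w => X w - foldX ε w.1 + w.2 - (6 - 2 * q w.1))
      (Icc (-(1 / 1000)) (1 / 1000) ×ˢ Icc 0 (40 * ε)) := by
    have h₁ : ContinuousOn X (Icc (-(1 / 1000)) (1 / 1000) ×ˢ Icc 0 (40 * ε)) :=
      hXc.mono (prod_mono le_rfl (Icc_subset_Icc_right (by linarith)))
    have h₂ : ContinuousOn (fun w : ℝ × ℝ => q w.1)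
        (Icc (-(1 / 1000)) (1 / 1000) ×ˢ Icc 0 (40 * ε)) :=
      hqc.comp (by fun_prop) fun w hw => hw.1
    have h₃ : Continuous fun w : ℝ × ℝ => foldX ε w.1 := by fun_prop
    exact ((h₁.sub h₃.continuousOn).add continuousOn_snd).sub
      (continuousOn_const.sub (continuousOn_const.mul h₂))
  have hX0 : ∀ s ∈ Icc (-(1 / 1000) : ℝ) (1 / 1000), X (s, 0) = foldX ε s := fun s hs => (hX s hs).1
  obtain ⟨d, hdc, hd⟩ := exists_continuousOn_root (by positivity) hcont
    (fun s hs r hr r' hr' hlt => by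
      have := hmono s hs hr hr' hlt.le
      simp only at this ⊢
      linarith)
    (fun s hs => by
      simp only [hX0 s hs]
      linarith [(hq s hs).1])
    (fun s hs => by
      have := hmono s hs h0 h40 (by positivity)
      simp only [hX0 s hs] at this ⊢
      linarith [(hq s hs).2.1])
  refine ⟨q, d, X, hqc, hdc, fun s hs => ⟨hq s hs, hX s hs, (hd s hs).1, ?_⟩⟩
  linarith [(hd s hs).2]

/-- The derivative of `cubic` vanishes at 1, so displacements of order `ε` near 1 change it only by
`O(ε²)`. -/
theorem abs_cubic_sub_le {x y δ : ℝ} (hδ0 : 0 ≤ δ) (hδ : δ ≤ 1) (hx : |x - 1| ≤ δ)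
    (hy : |y - 1| ≤ δ) : |cubic x - cubic y| ≤ 3 * δ * |x - y| := by
  have e : cubic x - cubic y = (x ^ 2 + x * y + y ^ 2 - 3) / 3 * (x - y) := by
    simp only [cubic]; ring
  rw [e, abs_mul]
  refine mul_le_mul_of_nonneg_right ?_ (abs_nonneg _)
  rw [abs_le] at hx hy ⊢
  constructor <;> nlinarith

/-- All the data of a sliding periodic orbit: it leaves the fold at time `s`, spends the time `q`
below the switching line, and slides for the time `d` before time `s + 6`. -/
theorem exists_matching {ε lam k : ℝ} (hε : 0 < ε) (hl : lam < 1) (hlam : lam ≠ -1)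
    (hεl : ε * (1 + |lam|) ≤ 1 / 100000) (hk : k * |1 + lam| = 20000 * (1 + |lam|))
    (hkε : k * ε ≤ 1 / 1000) :
    ∃ (s q d : ℝ) (X : ℝ → ℝ), |s| ≤ k * ε ∧ |s| ≤ 1 / 1000 ∧ q < 3 ∧ 3 - 9 * ε ≤ q ∧
      lowerHeight ε (s, q) = 0 ∧ IsSlidingArc ε lam s X ∧ d ∈ Ioo 0 (40 * ε) ∧
      X d = foldX ε s + 6 - 2 * q - d ∧
      cubic (X d) - cubic (foldX ε s - q) +
        ε * lam * (forcingPrimitive (s - d) - forcingPrimitive (s + q)) = 0 := by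
  have hε1 : ε ≤ 1 / 100000 := by nlinarith [abs_nonneg lam]
  obtain ⟨q, d, X, hqc, hdc, h⟩ := exists_landing hε hl hεl
  have hlam' : 0 < |1 + lam| := abs_pos.2 fun h => hlam (by linarith)
  have hk0 : 0 < k := by
    by_contra! hk'
    nlinarith [abs_nonneg lam]
  have hkε0 : 0 < k * ε := mul_pos hk0 hε
  have hsub : Icc (-(k * ε)) (k * ε) ⊆ Icc (-(1 / 1000)) (1 / 1000) :=
    Icc_subset_Icc (by linarith) hkε
  set Y : ℝ → ℝ := fun s => cubic (foldX ε s + 6 - 2 * q s - d s) - cubic (foldX ε s - q s) +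
    ε * lam * (forcingPrimitive (s - d s) - forcingPrimitive (s + q s)) with hY
  have hYc : ContinuousOn Y (Icc (-(k * ε)) (k * ε)) := by
    have h₁ := hqc.mono hsub
    have h₂ := hdc.mono hsub
    have h₃ : ContinuousOn (fun s => foldX ε s + 6 - 2 * q s - d s) (Icc (-(k * ε)) (k * ε)) := by
      fun_prop
    have h₄ : ContinuousOn (fun s => foldX ε s - q s) (Icc (-(k * ε)) (k * ε)) := by fun_prop
    have h₅ : ContinuousOn (fun s => s - d s) (Icc (-(k * ε)) (k * ε)) := by fun_prop
    have h₆ : ContinuousOn (fun s => s + q s) (Icc (-(k * ε)) (k * ε)) := by fun_prop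
    exact ((continuous_cubic.comp_continuousOn h₃).sub (continuous_cubic.comp_continuousOn h₄)).add
      (continuousOn_const.mul ((continuous_forcingPrimitive.comp_continuousOn h₅).sub
        (continuous_forcingPrimitive.comp_continuousOn h₆)))
  -- Closure of the lower arc eliminates `cubic (foldX ε s - q s)`. Since `q s` is within `9 * ε` of
  -- 3 and `d s` is below `40 * ε`, antiperiodicity replaces every remaining primitive by `±
  -- forcingPrimitive s`.
  have hYest : ∀ s ∈ Icc (-(k * ε)) (k * ε),
      |Y s - 2 * ε * (1 + lam) * forcingPrimitive s| ≤ 15000 * (1 + |lam|) * ε ^ 2 := by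
    intro s hs
    obtain ⟨⟨hq3, hq9, hlow⟩, -, hd, -⟩ := h s (hsub hs)
    have hb := foldX_bounds hε hε1 (abs_le.2 (hsub hs))
    rw [lowerHeight_eq hε hε1] at hlow
    have hp : forcingPrimitive (s + q s) = -forcingPrimitive (s + (q s - 3)) := by
      rw [← forcingPrimitive_add_three]; congr 1; ring
    have a₁ : |cubic (foldX ε s + 6 - 2 * q s - d s) - cubic (foldX ε s)| ≤
        3 * (61 * ε) * (60 * ε) := by
      refine (abs_cubic_sub_le (δ := 61 * ε) (by positivity) (by linarith) ?_ ?_).trans ?_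
      · rw [abs_le]; constructor <;> linarith [hd.1, hd.2]
      · rw [abs_le]; constructor <;> linarith
      · refine mul_le_mul_of_nonneg_left ?_ (by positivity)
        rw [abs_le]; constructor <;> linarith [hd.1, hd.2]
    have a₂ := abs_forcingPrimitive_sub_le s (s + (q s - 3))
    have a₃ := abs_forcingPrimitive_sub_le s (s - d s)
    have b₂ : |s + (q s - 3) - s| ≤ 9 * ε := by rw [abs_le]; constructor <;> linarith
    have b₃ : |s - d s - s| ≤ 40 * ε := by
      rw [abs_le]; constructor <;> linarith [hd.1, hd.2]
    have c₂ : |ε * (1 + lam) * (forcingPrimitive (s + (q s - 3)) - forcingPrimitive s)| ≤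
        ε * (1 + |lam|) * (9 * ε) := by
      rw [abs_mul, abs_mul, abs_of_pos hε]
      gcongr
      · simpa using abs_add_le (1 : ℝ) lam
      · exact a₂.trans b₂
    have c₃ : |ε * lam * (forcingPrimitive (s - d s) - forcingPrimitive s)| ≤
        ε * |lam| * (40 * ε) := by
      rw [abs_mul, abs_mul, abs_of_pos hε]
      gcongr
      exact a₃.trans b₃
    have e : Y s - 2 * ε * (1 + lam) * forcingPrimitive s =
        (cubic (foldX ε s + 6 - 2 * q s - d s) - cubic (foldX ε s)) +
        (ε * (1 + lam) * (forcingPrimitive (s + (q s - 3)) - forcingPrimitive s) +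
        ε * lam * (forcingPrimitive (s - d s) - forcingPrimitive s)) := by
      simp only [hY]
      rw [hp] at hlow ⊢
      linear_combination hlow
    rw [e]
    refine (abs_add_le _ _).trans ((add_le_add a₁ ((abs_add_le _ _).trans
      (add_le_add c₂ c₃))).trans ?_)
    nlinarith [abs_nonneg lam, mul_nonneg (abs_nonneg lam) (sq_nonneg ε), sq_nonneg ε]
  have hr := hYest (k * ε) ⟨by linarith, le_rfl⟩
  have hl' := hYest (-(k * ε)) ⟨le_rfl, by linarith⟩
  rw [forcingPrimitive_neg] at hl'
  have hC := half_le_forcingPrimitive hkε0.le (by linarith)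
  -- The factor 20000 in `k` is chosen to beat the error constant 15000, using `forcingPrimitive (k
  -- * ε) ≥ k * ε / 2`. Hence `Y` has opposite signs at the two endpoints.
  have hbig : 20000 * (1 + |lam|) * ε ^ 2 ≤ 2 * ε * |1 + lam| * forcingPrimitive (k * ε) := by
    rw [← hk]
    nlinarith [mul_pos hε hlam']
  have hsmall : 15000 * (1 + |lam|) * ε ^ 2 < 20000 * (1 + |lam|) * ε ^ 2 := by
    have : 0 < (1 + |lam|) * ε ^ 2 := by positivity
    linarith
  have hzero : (0 : ℝ) ∈ Y '' Icc (-(k * ε)) (k * ε) := by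
    rw [abs_le] at hr hl'
    rcases lt_or_gt_of_ne (abs_pos.1 hlam') with hneg | hpos
    · rw [abs_of_neg hneg] at hbig
      exact intermediate_value_Icc' (by linarith) hYc ⟨by linarith, by linarith⟩
    · rw [abs_of_pos hpos] at hbig
      exact intermediate_value_Icc (by linarith) hYc ⟨by linarith, by linarith⟩
  obtain ⟨s, hs, hs0⟩ := hzero
  obtain ⟨⟨hq3, hq9, hlow⟩, hX, hd, hXd⟩ := h s (hsub hs)
  refine ⟨s, q s, d s, fun r => X (s, r), abs_le.2 hs, abs_le.2 (hsub hs), hq3, hq9, hlow, hX, hd,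
    hXd, ?_⟩
  simp only [hXd]
  exact hs0

/-! ### Closed orbits made of three arcs -/

theorem ContDiff.exists_lipschitzOnWith_Icc {f : ℝ → ℝ × ℝ} (hf : ContDiff ℝ 1 f) (a b : ℝ) :
    ∃ K, LipschitzOnWith K f (Icc a b) :=
  (hf.locallyLipschitz.locallyLipschitzOn).exists_lipschitzOnWith_of_compact isCompact_Icc

namespace PiecewiseSystem

theorem IsTimePeriodic.exists_glued {Z : PiecewiseSystem} {T a b c : ℝ} (hZ : Z.IsTimePeriodic T)
    (hT : 0 < T) (hab : a < b) (hbc : b < c) (hcT : c ≤ a + T) {f g h : ℝ → ℝ × ℝ}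
    (hfg : f b = g b) (hgh : g c = h c) (hhf : h (a + T) = f a)
    (hfL : ∃ K, LipschitzOnWith K f (Icc a b)) (hgL : ∃ K, LipschitzOnWith K g (Icc b c))
    (hhL : ∃ K, LipschitzOnWith K h (Icc c (a + T)))
    (hf : ∀ t ∈ Ioo a b, ∃ w ∈ Z.filippovSet t (f t), HasDerivAt f w t)
    (hg : ∀ t ∈ Ioo b c, ∃ w ∈ Z.filippovSet t (g t), HasDerivAt g w t)
    (hh : ∀ t ∈ Ioo c (a + T), ∃ w ∈ Z.filippovSet t (h t), HasDerivAt h w t) :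
    ∃ u : ℝ → ℝ × ℝ, Z.IsLipschitzSolution u ∧ Function.Periodic u T ∧
      (∀ t ∈ Icc a b, t < a + T → u t = f t) ∧ (∀ t ∈ Icc b c, t < a + T → u t = g t) ∧
      (∀ t ∈ Ico c (a + T), u t = h t) ∧
      ∀ t, ∃ n : ℤ, t - n • T ∈ Ico a (a + T) ∧ u t = u (t - n • T) := by
  set v : ℝ → ℝ × ℝ := fun t => if t ≤ b then f t else if t ≤ c then g t else h t with hv
  have vf : EqOn v f (Icc a b) := fun t ht => if_pos ht.2
  have vg : EqOn v g (Icc b c) := fun t ht => by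
    rcases ht.1.eq_or_lt with rfl | hlt
    · simp [hv, hfg]
    · simp [hv, hlt.not_ge, ht.2]
  have vh : EqOn v h (Icc c (a + T)) := fun t ht => by
    rcases ht.1.eq_or_lt with rfl | hlt
    · simp [hv, hbc.not_ge, hgh]
    · simp [hv, hlt.not_ge, (hbc.trans hlt).not_ge]
  obtain ⟨K₁, h₁⟩ := hfL
  obtain ⟨K₂, h₂⟩ := hgL
  obtain ⟨K₃, h₃⟩ := hhL
  replace h₁ : LipschitzOnWith (K₁ + K₂ + K₃) v (Icc a b) := fun x hx y hy => by
    rw [vf hx, vf hy]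
    exact (h₁.weaken (by rw [add_assoc]; exact le_self_add)) hx hy
  replace h₂ : LipschitzOnWith (K₁ + K₂ + K₃) v (Icc b c) := fun x hx y hy => by
    rw [vg hx, vg hy]
    exact (h₂.weaken (by rw [add_right_comm]; exact le_add_self)) hx hy
  replace h₃ : LipschitzOnWith (K₁ + K₂ + K₃) v (Icc c (a + T)) := fun x hx y hy => by
    rw [vh hx, vh hy]
    exact (h₃.weaken le_add_self) hx hy
  have hL := (h₁.Icc_union hab.le hbc.le h₂).Icc_union (hab.trans hbc).le hcT h₃
  have hend : v (a + T) = v a := by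
    rw [vh ⟨hcT, le_rfl⟩, vf ⟨le_rfl, hab.le⟩, hhf]
  have transport : ∀ (k : ℝ → ℝ × ℝ) (x y : ℝ), EqOn v k (Icc x y) →
      (∀ t ∈ Ioo x y, ∃ w ∈ Z.filippovSet t (k t), HasDerivAt k w t) →
      ∀ t ∈ Ioo x y, ∃ w ∈ Z.filippovSet t (v t), HasDerivAt v w t := by
    intro k x y hk hsol t ht
    obtain ⟨w, hw, hd⟩ := hsol t ht
    have he : v =ᶠ[𝓝 t] k := by
      filter_upwards [isOpen_Ioo.mem_nhds ht] with r hr using hk (Ioo_subset_Icc_self hr)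
    exact ⟨w, by rwa [he.eq_of_nhds], hd.congr_of_eventuallyEq he⟩
  have self : ∀ t ∈ Ico a (a + T), v (toIcoMod hT a t) = v t := fun t ht => by
    rw [(toIcoMod_eq_self hT).2 ht]
  refine ⟨fun t => v (toIcoMod hT a t),
    hZ.isLipschitzSolution_comp_toIcoMod hT hL hend (N := {b, c}) (by simp) ?_,
    fun t => by simp only [toIcoMod_add_right], ?_, ?_, ?_, ?_⟩
  · intro t ht htN
    rw [mem_insert_iff, mem_singleton_iff, not_or] at htN
    rcases lt_or_gt_of_ne htN.1 with h | h
    · exact transport f a b vf hf t ⟨ht.1, h⟩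
    rcases lt_or_gt_of_ne htN.2 with h' | h'
    · exact transport g b c vg hg t ⟨h, h'⟩
    · exact transport _ c (a + T) vh hh t ⟨h', ht.2⟩
  · exact fun t ht hlt => (self t ⟨ht.1, hlt⟩).trans (vf ht)
  · exact fun t ht hlt => (self t ⟨hab.le.trans ht.1, hlt⟩).trans (vg ht)
  · exact fun t ht => (self t ⟨(hab.trans hbc).le.trans ht.1, ht.2⟩).trans (vh ⟨ht.1, ht.2.le⟩)
  · refine fun t => ⟨toIcoDiv hT a t, toIcoMod_mem_Ico hT a t, ?_⟩
    exact (self _ (toIcoMod_mem_Ico hT a t)).symm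

end PiecewiseSystem

theorem hasDerivAt_upperHeight (c x₁ T₁ t : ℝ) :
    HasDerivAt (fun t => cubic (x₁ + (t - T₁)) - cubic x₁ +
        c * (forcingPrimitive t - forcingPrimitive T₁))
      ((x₁ + (t - T₁)) ^ 2 - 1 + c * forcing t) t := by
  have h₁ : HasDerivAt (fun t : ℝ => x₁ + (t - T₁)) 1 t :=
    ((hasDerivAt_id t).sub_const T₁).const_add x₁
  have h₂ := (((h₁.pow 3).div_const 3).sub h₁).sub_const (cubic x₁)
  refine (h₂.add (((hasDerivAt_forcingPrimitive t).sub_const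
    (forcingPrimitive T₁)).const_mul c)).congr_deriv ?_
  norm_num

/-- During the last `13/5` units of time, expand backward from the landing: the linear term is
nonnegative because the arc lands with nonpositive vertical speed, and the quadratic term dominates
the forcing remainder. Earlier, `x ≤ -3/2` and the height strictly increases from 0. -/
theorem upperHeight_pos {c x₁ x₂ T₁ T₂ : ℝ} (hT : x₂ - x₁ = T₂ - T₁)
    (h0 : cubic x₂ - cubic x₁ + c * (forcingPrimitive T₂ - forcingPrimitive T₁) = 0)
    (hx : |x₂ - 1| ≤ 1 / 100) (hc : |c| ≤ 1 / 100) (hland : x₂ ^ 2 - 1 + c * forcing T₂ ≤ 0)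
    {t : ℝ} (ht : t ∈ Ioo T₁ T₂) :
    0 < cubic (x₁ + (t - T₁)) - cubic x₁ + c * (forcingPrimitive t - forcingPrimitive T₁) := by
  rw [abs_le] at hx
  rcases le_total (T₂ - 13 / 5) t with h | h
  · set p := T₂ - t with hp
    have e : x₁ + (t - T₁) = x₂ - p := by rw [hp]; linarith
    have hr := abs_forcingPrimitive_sub_sub_le T₂ t
    have hr' : |c * (forcingPrimitive t - forcingPrimitive T₂ - forcing T₂ * (t - T₂))| ≤
        1 / 100 * (2 * (t - T₂) ^ 2) := by
      rw [abs_mul]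
      exact mul_le_mul hc hr (abs_nonneg _) (by norm_num)
    have htp : t - T₂ = -p := by rw [hp]; ring
    rw [htp] at hr'
    have hr'' := (abs_le.1 hr').1
    have hp0 : 0 < p := by rw [hp]; linarith [ht.2]
    have hquad : 0 < p ^ 2 * (x₂ - p / 3 - 1 / 50) :=
      mul_pos (by positivity) (by linarith)
    have hlin : p * (x₂ ^ 2 - 1 + c * forcing T₂) ≤ 0 :=
      mul_nonpos_of_nonneg_of_nonpos hp0.le hland
    rw [e]
    simp only [cubic] at h0 ⊢
    linear_combination hquad + hlin + hr'' - h0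
  · have hmono : StrictMonoOn (fun t => cubic (x₁ + (t - T₁)) - cubic x₁ +
        c * (forcingPrimitive t - forcingPrimitive T₁)) (Icc T₁ (T₂ - 13 / 5)) := by
      refine strictMonoOn_of_hasDerivWithinAt_pos (convex_Icc _ _)
        (fun t _ => (hasDerivAt_upperHeight c x₁ T₁ t).continuousAt.continuousWithinAt)
        (fun t _ => (hasDerivAt_upperHeight c x₁ T₁ t).hasDerivWithinAt) fun t ht => ?_
      rw [interior_Icc] at ht
      have h₁ : |c * forcing t| ≤ 1 / 100 * 1 := by
        rw [abs_mul]
        exact mul_le_mul hc (abs_forcing_le t) (abs_nonneg _) (by norm_num)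
      have h₂ := (abs_le.1 h₁).1
      have h₃ : x₁ + (t - T₁) ≤ -3 / 2 := by linarith [ht.2]
      nlinarith
    have := hmono ⟨le_rfl, ht.1.le.trans h⟩ ⟨ht.1.le, h⟩ ht.1
    simpa using this

/-! ### The sliding orbit of the normalized system -/

/-- The normalized system, with forcing amplitudes `c` above and `ε` below the switching line. -/
noncomputable def normalizedSystem (c ε : ℝ) : PiecewiseSystem :=
  foldSystem 1 (fun t => c * forcing t) (fun t => ε * forcing t)

theorem isTimePeriodic_normalizedSystem (c ε : ℝ) : (normalizedSystem c ε).IsTimePeriodic 6 := by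
  constructor <;> intro t <;> simp [normalizedSystem, foldSystem, forcing_add_six]

theorem contDiff_lowerArc (ε x₀ s : ℝ) :
    ContDiff ℝ 1 fun t => (x₀ - (t - s), lowerHeight ε (s, t - s)) := by
  simp only [lowerHeight]
  fun_prop

theorem contDiff_upperArc (c x₁ T₁ : ℝ) :
    ContDiff ℝ 1 fun t => (x₁ + (t - T₁), cubic (x₁ + (t - T₁)) - cubic x₁ +
      c * (forcingPrimitive t - forcingPrimitive T₁)) := by
  unfold cubic
  fun_prop

theorem hasDerivAt_lowerArc {ε : ℝ} (hε : 0 < ε) (hε1 : ε ≤ 1 / 100000) (s t : ℝ) :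
    HasDerivAt (fun t => (foldX ε s - (t - s), lowerHeight ε (s, t - s)))
      (-1, (foldX ε s - (t - s)) ^ 2 - 1 + ε * forcing t) t := by
  have h₁ : HasDerivAt (fun t : ℝ => foldX ε s - (t - s)) (-1) t :=
    ((hasDerivAt_id t).sub_const s).const_sub _
  have h₂ := HasDerivAt.comp_sub_const t s (hasDerivAt_lowerHeight hε hε1 s (t - s))
  rw [add_sub_cancel] at h₂
  exact h₁.prodMk h₂

theorem hasDerivAt_upperArc (c x₁ T₁ t : ℝ) :
    HasDerivAt (fun t => (x₁ + (t - T₁), cubic (x₁ + (t - T₁)) - cubic x₁ +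
      c * (forcingPrimitive t - forcingPrimitive T₁)))
      (1, (x₁ + (t - T₁)) ^ 2 - 1 + c * forcing t) t :=
  (((hasDerivAt_id t).sub_const T₁).const_add x₁).prodMk (hasDerivAt_upperHeight c x₁ T₁ t)

theorem lowerHeight_neg_of_lt {ε s q t : ℝ} (hε : 0 < ε) (hε1 : ε ≤ 1 / 100000)
    (hs : |s| ≤ 1 / 1000) (hq : q ≤ 3) (h0 : lowerHeight ε (s, q) = 0) (ht : t ∈ Ioo 0 q) :
    lowerHeight ε (s, t) < 0 := by
  rcases le_total t (13 / 5) with h | h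
  · exact lowerHeight_neg hε hε1 hs ht.1 h
  · have := strictMonoOn_lowerHeight hε hε1 hs ⟨h, ht.2.le.trans hq⟩ ⟨h.trans ht.2.le, hq⟩ ht.2
    simpa [h0] using this

theorem slidingField_normalizedSystem (c ε t x y : ℝ) :
    (normalizedSystem c ε).slidingField t (x, y) =
      ((ε * forcing t - c * forcing t)⁻¹ *
        ((x ^ 2 - 1 + ε * forcing t) + (x ^ 2 - 1 + c * forcing t)), 0) := by
  ext
  · simp only [slidingField, normalizedSystem, foldSystem, Prod.smul_fst, Prod.fst_sub, smul_eq_mul]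
    ring
  · simp only [slidingField, normalizedSystem, foldSystem, Prod.smul_snd, Prod.snd_sub, smul_eq_mul]
    ring

/-! ### The sliding arc as a trajectory of the sliding field -/

section

variable {ε lam s d : ℝ} {X : ℝ → ℝ}

/-- The lower vertical component is `W > 0`, and the upper one is `W` minus the strip width, hence
negative by the `3/4` barrier. The end `t = s + 6` is excluded: there the lower field is tangent. -/
theorem IsSlidingArc.mem_slidingRegion (hX : IsSlidingArc ε lam s X) (hε : 0 < ε) (hl : lam < 1)
    (hεl : ε * (1 + |lam|) ≤ 1 / 100000) (hs : |s| ≤ 1 / 1000) {t : ℝ}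
    (h0 : t < s + 6) (h40 : s + 6 - t ≤ 40 * ε) :
    (t, X (s + 6 - t), 0) ∈ (normalizedSystem (ε * lam) ε).slidingRegion := by
  have hε1 : ε ≤ 1 / 100000 := by nlinarith [abs_nonneg lam]
  obtain ⟨-, -, h₁, h₂⟩ := hX.bounds hε hl hεl hs (s + 6 - t) ⟨by linarith, h40⟩
  have hf : forcing (s - (s + 6 - t)) = forcing t := by
    rw [← forcing_add_six]; congr 1; ring
  have hf1 : 49 / 50 ≤ forcing t := by
    rw [← hf]
    refine forcing_ge ?_
    rw [abs_le] at hs ⊢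
    constructor <;> linarith [hs.1, hs.2]
  rw [hf] at h₁ h₂
  have hD : 0 < ε * (1 - lam) * forcing t := mul_pos (mul_pos hε (sub_pos.2 hl)) (by linarith)
  refine ⟨rfl, ?_, ?_⟩
  · simp only [normalizedSystem, foldSystem]
    linarith
  · simp only [normalizedSystem, foldSystem]
    exact h₂ (by linarith)

theorem IsSlidingArc.hasDerivAt (hX : IsSlidingArc ε lam s X) (hε : 0 < ε) (hl : lam < 1)
    (hεl : ε * (1 + |lam|) ≤ 1 / 100000) (hs : |s| ≤ 1 / 1000) {t : ℝ}
    (h0 : t < s + 6) (h40 : s + 6 - t < 40 * ε) :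
    HasDerivAt (fun t => (X (s + 6 - t), (0 : ℝ)))
      ((normalizedSystem (ε * lam) ε).slidingField t (X (s + 6 - t), 0)) t := by
  have hε1 : ε ≤ 1 / 100000 := by nlinarith [abs_nonneg lam]
  have hr : s + 6 - t ∈ Ioo 0 (40 * ε) := ⟨by linarith, h40⟩
  have hd : HasDerivAt X (-slideSpeed ε lam (X (s + 6 - t), s - (s + 6 - t))) (s + 6 - t) :=
    (hX.2 _ ⟨hr.1.le, by linarith⟩).hasDerivAt (Icc_mem_nhds hr.1 (by linarith))
  have hf : forcing (s - (s + 6 - t)) = forcing t := by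
    rw [← forcing_add_six]; congr 1; ring
  have hf1 : 49 / 50 ≤ forcing t := by
    rw [← hf]
    refine forcing_ge ?_
    rw [abs_le] at hs ⊢
    constructor <;> linarith [hs.1, hs.2]
  rw [(hX.slideSpeed_eq hε hl hεl hs _ ⟨hr.1.le, hr.2.le⟩).1, hf] at hd
  refine ((HasDerivAt.comp_const_sub (s + 6) t hd).prodMk (hasDerivAt_const t (0 : ℝ))).congr_deriv ?_
  rw [slidingField_normalizedSystem]
  have h₁ : 1 - lam ≠ 0 := by linarith
  have h₂ : forcing t ≠ 0 := by linarith
  have h₃ : ε * forcing t - ε * lam * forcing t = ε * (1 - lam) * forcing t := by ring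
  rw [h₃]
  ext
  · simp only
    field_simp
    ring
  · rfl

theorem IsSlidingArc.exists_lipschitzOnWith (hX : IsSlidingArc ε lam s X) (hd : d ≤ 1 / 4) :
    ∃ K, LipschitzOnWith K (fun t => (X (s + 6 - t), (0 : ℝ))) (Icc (s + 6 - d) (s + 6)) := by
  have h₁ : LipschitzOnWith 1 X (Icc 0 (1 / 4)) :=
    (convex_Icc (0 : ℝ) (1 / 4)).lipschitzOnWith_of_nnnorm_hasDerivWithin_le hX.2 fun r _ => by
      rw [nnnorm_neg, ← NNReal.coe_le_coe]
      exact abs_slideSpeed_le _ _ _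
  have h₂ : LipschitzOnWith 1 (fun t => s + 6 - t) (Icc (s + 6 - d) (s + 6)) :=
    LipschitzOnWith.of_dist_le_mul fun x _ y _ => by
      rw [dist_sub_left]; simp
  exact ⟨_, (h₁.comp h₂ fun t ht => ⟨by linarith [ht.2], by linarith [ht.1]⟩).prodMk
    (LipschitzWith.const (0 : ℝ)).lipschitzOnWith⟩

end

theorem exists_sliding_orbit {ε lam k : ℝ} (hε : 0 < ε) (hl : lam < 1) (hlam : lam ≠ -1)
    (hεl : ε * (1 + |lam|) ≤ 1 / 100000) (hk : k * |1 + lam| = 20000 * (1 + |lam|))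
    (hkε : k * ε ≤ 1 / 1000) :
    ∃ (s : ℝ) (u : ℝ → ℝ × ℝ), (normalizedSystem (ε * lam) ε).IsLipschitzSlidingSolution 6
      (normalizedSystem (ε * lam) ε).slidingRegion u ∧ |s| ≤ k * ε ∧ dist (u s) (1, 0) ≤ ε := by
  have hε1 : ε ≤ 1 / 100000 := by nlinarith [abs_nonneg lam]
  obtain ⟨s, q, d, X, hsk, hs, hq3, hq9, hlow, hX, hd, hXd, hup⟩ :=
    exists_matching hε hl hlam hεl hk hkε
  have hx₀ := foldX_bounds hε hε1 hs
  set x₀ := foldX ε s with hx₀def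
  set Z := normalizedSystem (ε * lam) ε with hZ
  have hZper : Z.IsTimePeriodic 6 := isTimePeriodic_normalizedSystem _ _
  have hc : |ε * lam| ≤ 1 / 100 := by
    rw [abs_mul, abs_of_pos hε]; nlinarith
  -- The landing point lies in the sliding region, so the upper field points down there, as
  -- `upperHeight_pos` requires.
  have hland := (hX.mem_slidingRegion hε hl hεl hs (t := s + 6 - d) (by linarith [hd.1])
    (by linarith [hd.2])).2.1
  simp only [normalizedSystem, foldSystem, sub_sub_cancel] at hland
  have hper : forcingPrimitive (s + 6 - d) = forcingPrimitive (s - d) := by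
    rw [← forcingPrimitive_add_six (s - d)]; congr 1; ring
  rw [← hper] at hup
  have hupper : ∀ t ∈ Ioo (s + q) (s + 6 - d), 0 < cubic (x₀ - q + (t - (s + q))) -
      cubic (x₀ - q) + ε * lam * (forcingPrimitive t - forcingPrimitive (s + q)) := fun t ht => by
    refine upperHeight_pos (by linarith) hup ?_ hc hland.le ht
    rw [hXd, abs_le]; constructor <;> linarith [hd.1, hd.2]
  have hlower : ∀ t ∈ Ioo s (s + q), lowerHeight ε (s, t - s) < 0 := fun t ht =>
    lowerHeight_neg_of_lt hε hε1 hs hq3.le hlow ⟨by linarith [ht.1], by linarith [ht.2]⟩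
  have hslide : ∀ t ∈ Ico (s + 6 - d) (s + 6), (t, X (s + 6 - t), 0) ∈ Z.slidingRegion :=
    fun t ht => hX.mem_slidingRegion hε hl hεl hs ht.2 (by linarith [ht.1, hd.2])
  have hslide' : ∀ t ∈ Ico (s + 6 - d) (s + 6), HasDerivAt (fun t => (X (s + 6 - t), (0 : ℝ)))
      (Z.slidingField t (X (s + 6 - t), 0)) t :=
    fun t ht => hX.hasDerivAt hε hl hεl hs ht.2 (by linarith [ht.1, hd.2])
  obtain ⟨u, hu, huper, hu₁, hu₂, hu₃, hred⟩ := hZper.exists_glued (a := s) (b := s + q)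
    (c := s + 6 - d) (by norm_num) (by linarith) (by linarith [hd.2]) (by linarith [hd.1])
    (f := fun t => (x₀ - (t - s), lowerHeight ε (s, t - s)))
    (g := fun t => (x₀ - q + (t - (s + q)), cubic (x₀ - q + (t - (s + q))) - cubic (x₀ - q) +
      ε * lam * (forcingPrimitive t - forcingPrimitive (s + q))))
    (h := fun t => (X (s + 6 - t), 0))
    (by simp [hlow])
    (by
      have e : x₀ - q + (s + 6 - d - (s + q)) = X d := by rw [hXd]; ring
      simp only [e, hup, sub_sub_cancel])
    (by simp [hX.1, lowerHeight, hx₀def])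
    ((contDiff_lowerArc _ _ _).exists_lipschitzOnWith_Icc _ _)
    ((contDiff_upperArc _ _ _).exists_lipschitzOnWith_Icc _ _)
    (hX.exists_lipschitzOnWith (by linarith [hd.2]))
    (fun t ht => ⟨_, Or.inr (Or.inl ⟨hlower t ht, rfl⟩), hasDerivAt_lowerArc hε hε1 s t⟩)
    (fun t ht => ⟨_, Or.inl ⟨hupper t ht, rfl⟩, hasDerivAt_upperArc _ _ _ t⟩)
    (fun t ht => ⟨_, slidingField_mem_filippovSet (hslide t ⟨ht.1.le, ht.2⟩),
      hslide' t ⟨ht.1.le, ht.2⟩⟩)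
  have hus : u s = (x₀, 0) := by
    rw [hu₁ s ⟨le_rfl, by linarith⟩ (by linarith)]
    simp [lowerHeight]
  refine ⟨s, u, ⟨hu, huper, ⟨s + 6 - d, s + 6, by linarith [hd.1], fun t ht => ?_⟩, ?_⟩, hsk, ?_⟩
  · rw [hu₃ t ⟨ht.1.le, ht.2⟩]
    refine ⟨hslide t ⟨ht.1.le, ht.2⟩, (hslide' t ⟨ht.1.le, ht.2⟩).congr_of_eventuallyEq ?_⟩
    filter_upwards [isOpen_Ioo.mem_nhds ht] with r hr using hu₃ r ⟨hr.1.le, hr.2⟩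
  · have key : ∀ t ∈ Ico s (s + 6), (t, u t) ∈ Z.slidingRegion ∪ Z.escapingRegion →
        (t, u t) ∈ Z.slidingRegion := by
      intro t ht hmem
      rcases le_or_gt (s + 6 - d) t with h₃ | h₃
      · rw [hu₃ t ⟨h₃, ht.2⟩]
        exact hslide t ⟨h₃, ht.2⟩
      exfalso
      have hsw : (u t).2 = 0 := by rcases hmem with h | h <;> exact h.1
      have hprod : (Z.pos t (u t)).2 < 0 ∧ 0 < (Z.neg t (u t)).2 ∨
          0 < (Z.pos t (u t)).2 ∧ (Z.neg t (u t)).2 < 0 := by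
        rcases hmem with h | h
        · exact Or.inl h.2
        · exact Or.inr h.2
      rcases lt_or_ge (s + q) t with h₂ | h₂
      · rw [hu₂ t ⟨h₂.le, h₃.le⟩ ht.2] at hsw
        exact (hupper t ⟨h₂, h₃⟩).ne' hsw
      rcases h₂.eq_or_lt with rfl | h₂
      -- At the passage from the lower to the upper arc, `x` is near `-2` and both vertical
      -- components are positive.
      · rw [hu₁ _ ⟨by linarith, le_rfl⟩ ht.2] at hprod
        simp only [hZ, normalizedSystem, foldSystem, add_sub_cancel_left] at hprod
        have hn : |ε * forcing (s + q)| ≤ 1 / 100 * 1 := by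
          rw [abs_mul, abs_of_pos hε]
          exact mul_le_mul (by linarith) (abs_forcing_le _) (abs_nonneg _) (by norm_num)
        have hp : |ε * lam * forcing (s + q)| ≤ 1 / 100 * 1 := by
          rw [abs_mul]
          exact mul_le_mul hc (abs_forcing_le _) (abs_nonneg _) (by norm_num)
        have hsq : 3 ≤ (x₀ - q) ^ 2 := by nlinarith
        rw [abs_le] at hn hp
        rcases hprod with h | h <;> linarith [h.1, h.2]
      rcases ht.1.eq_or_lt with rfl | h₁
      -- At the fold the lower vertical component is exactly 0, so the point is in neither region.
      · rw [hus] at hprod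
        have := foldX_sq hε hε1 s
        simp only [hZ, normalizedSystem, foldSystem, hx₀def] at hprod
        rcases hprod with h | h <;> linarith [h.1, h.2]
      · rw [hu₁ t ⟨h₁.le, h₂.le⟩ ht.2] at hsw
        exact (hlower t ⟨h₁, h₂⟩).ne hsw
    intro t ht
    obtain ⟨n, hn, hun⟩ := hred t
    rw [hun] at ht ⊢
    rw [← hZper.mem_slidingRegion_sub_zsmul n]
    refine key _ hn ?_
    rcases ht with ht | ht
    · exact Or.inl ((hZper.mem_slidingRegion_sub_zsmul n _ _).2 ht)
    · exact Or.inr ((hZper.mem_escapingRegion_sub_zsmul n _ _).2 ht)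
  · rw [hus, Prod.dist_eq, Real.dist_eq, dist_self]
    exact max_le (abs_le.2 ⟨by linarith, by linarith⟩) hε.le

/-! ### The crossing orbit of the normalized system -/

theorem forcingPrimitive_nonneg {t : ℝ} (h0 : 0 ≤ t) (h3 : t ≤ 3) : 0 ≤ forcingPrimitive t := by
  have := Real.pi_pos
  refine div_nonneg (Real.sin_nonneg_of_nonneg_of_le_pi (by positivity) ?_) (by positivity)
  nlinarith

theorem forcing_three : forcing 3 = -1 := by
  rw [← forcing_zero, ← forcing_add_three, zero_add]

theorem forcingPrimitive_three : forcingPrimitive 3 = 0 := by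
  rw [← zero_add (3 : ℝ), forcingPrimitive_add_three, forcingPrimitive_zero, neg_zero]

theorem forcingPrimitive_six : forcingPrimitive 6 = 0 := by
  rw [← zero_add (6 : ℝ), forcingPrimitive_add_six, forcingPrimitive_zero]

/-- A Lipschitz version of `IsCrossingPeriodicSolution`. -/
def PiecewiseSystem.IsLipschitzCrossingSolution (Z : PiecewiseSystem) (T : ℝ)
    (u : ℝ → ℝ × ℝ) : Prop :=
  Z.IsLipschitzSolution u ∧ Function.Periodic u T ∧ (∃ t : ℝ, (t, u t) ∈ switching) ∧
    ∀ t : ℝ, (t, u t) ∈ switching → (t, u t) ∈ Z.crossingRegion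

theorem hasDerivAt_descendingArc (c t : ℝ) :
    HasDerivAt (fun t => (1 - t, t ^ 2 * (t / 3 - 1) + c * forcingPrimitive t))
      (-1, (1 - t) ^ 2 - 1 + c * forcing t) t := by
  have h₁ : HasDerivAt (fun t : ℝ => t ^ 2 * (t / 3 - 1))
      (2 * t * (t / 3 - 1) + t ^ 2 * (1 / 3)) t :=
    (((hasDerivAt_id t).pow 2).mul (((hasDerivAt_id t).div_const 3).sub_const 1)).congr_deriv
      (by simp)
  refine (((hasDerivAt_id t).const_sub 1).prodMk
    (h₁.add ((hasDerivAt_forcingPrimitive t).const_mul c))).congr_deriv ?_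
  ext
  · rfl
  · simp only; ring

theorem contDiff_descendingArc (c : ℝ) :
    ContDiff ℝ 1 fun t => (1 - t, t ^ 2 * (t / 3 - 1) + c * forcingPrimitive t) := by
  fun_prop

/-- No smallness is needed. The unperturbed arcs from `(1, 0)` to `(-2, 0)` and back receive forcing
terms of their own sign, and the negative amplitudes make `(1, 0)` at time 0 a crossing point. -/
theorem exists_crossing_orbit {ε c : ℝ} (hε : 0 < ε) (hc : 0 < c) :
    ∃ u : ℝ → ℝ × ℝ, (normalizedSystem (-c) (-ε)).IsLipschitzCrossingSolution 6 u ∧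
      u 0 = (1, 0) := by
  set Z := normalizedSystem (-c) (-ε) with hZ
  have hZper : Z.IsTimePeriodic 6 := isTimePeriodic_normalizedSystem _ _
  have hlower : ∀ t ∈ Ioo (0 : ℝ) 3, t ^ 2 * (t / 3 - 1) + -ε * forcingPrimitive t < 0 :=
    fun t ht => by
      have h₁ : t ^ 2 * (t / 3 - 1) < 0 :=
        mul_neg_of_pos_of_neg (pow_pos ht.1 2) (by linarith [ht.2])
      have h₂ := mul_nonneg hε.le (forcingPrimitive_nonneg ht.1.le ht.2.le)
      linarith
  have hupper : ∀ t ∈ Ioo (3 : ℝ) 6, 0 < cubic (-2 + (t - 3)) - cubic (-2) +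
      -c * (forcingPrimitive t - forcingPrimitive 3) := fun t ht => by
    have h₁ : forcingPrimitive t = -forcingPrimitive (t - 3) := by
      rw [← forcingPrimitive_add_three, sub_add_cancel]
    have h₂ := mul_nonneg hc.le
      (forcingPrimitive_nonneg (t := t - 3) (by linarith [ht.1]) (by linarith [ht.2]))
    have h₃ : cubic (-2 + (t - 3)) - cubic (-2) = (t - 3) * (6 - t) ^ 2 / 3 := by
      simp only [cubic]; ring
    have h₄ : 0 < (t - 3) * (6 - t) ^ 2 / 3 :=
      div_pos (mul_pos (by linarith [ht.1]) (pow_pos (by linarith [ht.2]) 2)) (by norm_num)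
    rw [h₃, h₁, forcingPrimitive_three]
    linarith
  -- Only two arcs are needed: `c = a + T` reduces the third to a point.
  obtain ⟨u, hu, huper, hu₁, hu₂, -, hred⟩ := hZper.exists_glued (a := 0) (b := 3) (c := 6)
    (by norm_num) (by norm_num) (by norm_num) (by norm_num)
    (f := fun t => (1 - t, t ^ 2 * (t / 3 - 1) + -ε * forcingPrimitive t))
    (g := fun t => (-2 + (t - 3), cubic (-2 + (t - 3)) - cubic (-2) +
      -c * (forcingPrimitive t - forcingPrimitive 3)))
    (h := fun _ => (1, 0))
    (by norm_num [forcingPrimitive_three])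
    (by norm_num [forcingPrimitive_three, forcingPrimitive_six, cubic])
    (by simp [forcingPrimitive_zero])
    ((contDiff_descendingArc _).exists_lipschitzOnWith_Icc _ _)
    ((contDiff_upperArc _ _ _).exists_lipschitzOnWith_Icc _ _)
    ⟨0, (LipschitzWith.const _).lipschitzOnWith⟩
    (fun t ht => ⟨_, Or.inr (Or.inl ⟨hlower t ht, rfl⟩), hasDerivAt_descendingArc _ t⟩)
    (fun t ht => ⟨_, Or.inl ⟨hupper t ht, rfl⟩, hasDerivAt_upperArc _ _ _ t⟩)
    (fun t ht => by
      have := ht.1.trans ht.2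
      norm_num at this)
  have hu0 : u 0 = (1, 0) := by
    rw [hu₁ 0 ⟨le_rfl, by norm_num⟩ (by norm_num)]
    simp [forcingPrimitive_zero]
  refine ⟨u, ⟨hu, huper, ⟨0, by simp [switching, hu0]⟩, ?_⟩, hu0⟩
  have key : ∀ t ∈ Ico (0 : ℝ) (0 + 6), (t, u t) ∈ switching → (t, u t) ∈ Z.crossingRegion := by
    intro t ht hsw
    refine ⟨hsw, ?_⟩
    change (u t).2 = 0 at hsw
    rcases lt_or_ge 3 t with h₂ | h₂
    · have ht6 : t < 6 := by linarith [ht.2]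
      rw [hu₂ t ⟨h₂.le, ht6.le⟩ ht.2] at hsw
      exact absurd hsw (hupper t ⟨h₂, ht6⟩).ne'
    rcases h₂.eq_or_lt with rfl | h₂
    · rw [hu₁ _ ⟨by norm_num, le_rfl⟩ ht.2]
      simp only [hZ, normalizedSystem, foldSystem, forcing_three]
      exact mul_pos (by linarith) (by linarith)
    rcases ht.1.eq_or_lt with rfl | h₁
    · rw [hu0]
      simp only [hZ, normalizedSystem, foldSystem, forcing_zero]
      exact mul_pos_of_neg_of_neg (by linarith) (by linarith)
    · rw [hu₁ t ⟨h₁.le, h₂.le⟩ ht.2] at hsw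
      exact absurd hsw (hlower t ⟨h₁, h₂⟩).ne
  intro t ht
  obtain ⟨n, hn, hun⟩ := hred t
  rw [hun] at ht ⊢
  rw [← hZper.mem_crossingRegion_sub_zsmul n]
  exact key _ hn ht

theorem IsLipschitzCrossingSolution.scaled {T a θ : ℝ} {p n P N : ℝ → ℝ} {u : ℝ → ℝ × ℝ}
    (ha : 0 < a)
    (hP : ∀ t, P t = a ^ 2 * p ((t - θ) / a)) (hN : ∀ t, N t = a ^ 2 * n ((t - θ) / a))
    (h : (foldSystem 1 p n).IsLipschitzCrossingSolution T u) :
    (foldSystem (a ^ 2) P N).IsCrossingPeriodicSolution (T * a)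
      fun t => (a * (u ((t - θ) / a)).1, a ^ 3 * (u ((t - θ) / a)).2) := by
  obtain ⟨h₁, h₂, ⟨b, h₃⟩, h₄⟩ := h
  refine ⟨(IsLipschitzSolution.scaled ha hP hN h₁).isFilippovSolution, h₂.scaled ha,
    ⟨a * b + θ, ?_⟩, fun t ht => ?_⟩
  · have e : (a * b + θ - θ) / a = b := by field_simp; ring
    simp only [e]
    exact (mem_switching_scaled ha _ b _).2 h₃
  · exact (mem_crossingRegion_scaled ha hP hN _ _).2
      (h₄ _ ((mem_switching_scaled ha _ _ _).1 ht))

/-! ### Families of solutions -/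

theorem HasSolutionsNear.scaled {P Q : ℝ → (ℝ → ℝ × ℝ) → Prop} {a μ θ : ℝ} (ha : 0 < a)
    (hμ : 0 < μ) (h : HasSolutionsNear P 0 (1, 0))
    (hPQ : ∀ ε > 0, ∀ u, P (μ * ε) u →
      Q ε fun t => (a * (u ((t - θ) / a)).1, a ^ 3 * (u ((t - θ) / a)).2)) :
    HasSolutionsNear Q θ (a, 0) := by
  obtain ⟨C, hC, ε₀, hε₀, h⟩ := h
  -- The factor `a` serves the errors in time and abscissa, `a ^ 3` the error in height, and `μ`
  -- converts `ε` into the normalized amplitude.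
  refine ⟨(a + a ^ 3) * (C * μ), by positivity, ε₀ / μ, by positivity, fun ε hε hlt => ?_⟩
  rw [lt_div_iff₀ hμ, mul_comm] at hlt
  obtain ⟨s, u, hu, hs, hd⟩ := h (μ * ε) (by positivity) hlt
  have hB : 0 ≤ C * μ * ε := by positivity
  have e : (a * s + θ - θ) / a = s := by field_simp; ring
  rw [sub_zero] at hs
  rw [Prod.dist_eq, Real.dist_eq, Real.dist_eq, sub_zero, max_le_iff] at hd
  refine ⟨a * s + θ, _, hPQ ε hε u hu, ?_, ?_⟩
  · rw [add_sub_cancel_right, abs_mul, abs_of_pos ha]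
    nlinarith [pow_pos ha 3, mul_le_mul_of_nonneg_left hs ha.le]
  · simp only [e]
    rw [Prod.dist_eq, Real.dist_eq, Real.dist_eq, sub_zero]
    refine max_le ?_ ?_
    · rw [show a * (u s).1 - a = a * ((u s).1 - 1) by ring, abs_mul, abs_of_pos ha]
      nlinarith [pow_pos ha 3, mul_le_mul_of_nonneg_left hd.1 ha.le]
    · rw [abs_mul, abs_of_pos (pow_pos ha 3)]
      nlinarith [pow_pos ha 3, mul_le_mul_of_nonneg_left hd.2 (pow_pos ha 3).le]

theorem HasSolutionsNear.reversed {P Q : ℝ → (ℝ → ℝ × ℝ) → Prop}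
    (h : HasSolutionsNear P 0 (1, 0))
    (hPQ : ∀ ε u, P ε u → Q ε fun t => ((u (-t)).1, -(u (-t)).2)) :
    HasSolutionsNear Q 0 (1, 0) := by
  obtain ⟨C, hC, ε₀, hε₀, h⟩ := h
  refine ⟨C, hC, ε₀, hε₀, fun ε hε hlt => ?_⟩
  obtain ⟨s, u, hu, hs, hd⟩ := h ε hε hlt
  refine ⟨-s, _, hPQ ε u hu, by simpa using hs, ?_⟩
  rw [Prod.dist_eq, Real.dist_eq, Real.dist_eq] at hd ⊢
  simpa using hd

theorem hasSolutionsNear_sliding {lam : ℝ} (hl : lam < 1) (hlam : lam ≠ -1) :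
    HasSolutionsNear (fun ε u => (normalizedSystem (ε * lam) ε).IsLipschitzSlidingSolution 6
      (normalizedSystem (ε * lam) ε).slidingRegion u) 0 (1, 0) := by
  have hlam' : 0 < |1 + lam| := abs_pos.2 fun h => hlam (by linarith)
  set k := 20000 * (1 + |lam|) / |1 + lam| with hk
  have hk0 : 0 < k := by positivity
  -- Each summand of the denominator enforces one smallness condition of `exists_sliding_orbit`.
  refine ⟨k + 1, by positivity, 1 / (100000 * (1 + |lam|) + 1000 * k), by positivity,
    fun ε hε hlt => ?_⟩
  rw [lt_div_iff₀ (by positivity)] at hlt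
  have h₁ : 0 < ε * (1 + |lam|) := by positivity
  have h₂ : 0 < k * ε := by positivity
  obtain ⟨s, u, hu, hs, hd⟩ := exists_sliding_orbit hε hl hlam (k := k) (by linarith)
    (div_mul_cancel₀ _ hlam'.ne') (by linarith)
  exact ⟨s, u, hu, by rw [sub_zero]; linarith, by linarith⟩

theorem hasSolutionsNear_escaping {lam : ℝ} (hl : lam < 1) (hlam : lam ≠ -1) :
    HasSolutionsNear (fun ε u => (normalizedSystem ε (ε * lam)).IsLipschitzSlidingSolution 6
      (normalizedSystem ε (ε * lam)).escapingRegion u) 0 (1, 0) :=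
  (hasSolutionsNear_sliding hl hlam).reversed fun ε u hu =>
    IsLipschitzSlidingSolution.reversed (fun t => by simp only [forcing_neg])
      (fun t => by simp only [forcing_neg]) hu

theorem hasSolutionsNear_crossing {lam : ℝ} (hl : 0 < lam) :
    HasSolutionsNear (fun ε u =>
      (normalizedSystem (-(ε * lam)) (-ε)).IsLipschitzCrossingSolution 6 u) 0 (1, 0) := by
  refine ⟨1, one_pos, 1, one_pos, fun ε hε _ => ?_⟩
  obtain ⟨u, hu, hu0⟩ := exists_crossing_orbit hε (mul_pos hε hl)
  exact ⟨0, u, hu, by simpa using hε.le, by simpa [hu0] using hε.le⟩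

theorem hamiltonianModel_eq_foldSystem (α lam σ ε : ℝ) : hamiltonianModel α lam σ ε =
    foldSystem α (fun t => ε * (lam * Real.sin (Real.pi * t / σ)))
      (fun t => ε * Real.sin (Real.pi * t / σ)) := by
  simp [hamiltonianModel, foldSystem]

theorem forcing_quarter {a : ℝ} (ha : 0 < a) (t : ℝ) :
    forcing ((t - 3 * a / 2) / a) = Real.sin (Real.pi * t / (3 * a)) := by
  rw [forcing, ← Real.cos_sub_pi_div_two]
  congr 1
  field_simp

theorem forcing_three_quarters {a : ℝ} (ha : 0 < a) (t : ℝ) :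
    forcing ((t - 9 * a / 2) / a) = -Real.sin (Real.pi * t / (3 * a)) := by
  have e : (t - 3 * a / 2) / a = (t - 9 * a / 2) / a + 3 := by field_simp; ring
  rw [← forcing_quarter ha, e, forcing_add_three, neg_neg]

theorem mainTheorem5 (α lam σ : ℝ) (hα : 0 < α) (hσ : σ = 3 * √α) (hlam : lam ≠ -1) :
    ((lam < 1 → HasSolutionsNear
        (fun ε u => (hamiltonianModel α lam σ ε).IsSlidingPeriodicSolution (6 * √α)
          (hamiltonianModel α lam σ ε).slidingRegion u)
        (3 * √α / 2) (√α, 0)) ∧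
      (1 < lam → HasSolutionsNear
        (fun ε u => (hamiltonianModel α lam σ ε).IsSlidingPeriodicSolution (6 * √α)
          (hamiltonianModel α lam σ ε).escapingRegion u)
        (3 * √α / 2) (√α, 0))) ∧
    (lam < 0 → HasSolutionsNear
        (fun ε u => (hamiltonianModel α lam σ ε).IsSlidingPeriodicSolution (6 * √α)
          (hamiltonianModel α lam σ ε).escapingRegion u)
        (9 * √α / 2) (√α, 0)) ∧
    (0 < lam → HasSolutionsNear
        (fun ε u => (hamiltonianModel α lam σ ε).IsCrossingPeriodicSolution (6 * √α) u)
        (9 * √α / 2) (√α, 0)) := by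
  obtain ⟨a, ha, rfl⟩ : ∃ a : ℝ, 0 < a ∧ α = a ^ 2 :=
    ⟨√α, Real.sqrt_pos.2 hα, (Real.sq_sqrt hα.le).symm⟩
  rw [Real.sqrt_sq ha.le] at hσ ⊢
  subst hσ
  simp only [hamiltonianModel_eq_foldSystem]
  have hinv : lam⁻¹ ≠ -1 := fun h => hlam (by rw [← inv_inv lam, h]; norm_num)
  refine ⟨⟨fun h => ?_, fun h => ?_⟩, fun h => ?_, fun h => ?_⟩
  · refine (hasSolutionsNear_sliding h hlam).scaled ha (μ := 1 / a ^ 2) (by positivity)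
      fun ε hε u hu => ?_
    have hP : ∀ t, ε * (lam * Real.sin (Real.pi * t / (3 * a))) =
        a ^ 2 * (1 / a ^ 2 * ε * lam * forcing ((t - 3 * a / 2) / a)) := fun t => by
      rw [forcing_quarter ha]; field_simp
    have hN : ∀ t, ε * Real.sin (Real.pi * t / (3 * a)) =
        a ^ 2 * (1 / a ^ 2 * ε * forcing ((t - 3 * a / 2) / a)) := fun t => by
      rw [forcing_quarter ha]; field_simp
    exact (IsLipschitzSlidingSolution.scaled ha hP hN
      (mem_slidingRegion_scaled ha hP hN) hu).isSlidingPeriodicSolution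
  · have hl0 : 0 < lam := by linarith
    -- For `lam > 1` the upper amplitude is the larger one. It serves as the parameter, and the
    -- lower one is `lam⁻¹` times it.
    refine (hasSolutionsNear_escaping (inv_lt_one_of_one_lt₀ h) hinv).scaled ha
      (μ := lam / a ^ 2) (by positivity) fun ε hε u hu => ?_
    have hP : ∀ t, ε * (lam * Real.sin (Real.pi * t / (3 * a))) =
        a ^ 2 * (lam / a ^ 2 * ε * forcing ((t - 3 * a / 2) / a)) := fun t => by
      rw [forcing_quarter ha]; field_simp
    have hN : ∀ t, ε * Real.sin (Real.pi * t / (3 * a)) =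
        a ^ 2 * (lam / a ^ 2 * ε * lam⁻¹ * forcing ((t - 3 * a / 2) / a)) := fun t => by
      rw [forcing_quarter ha]; field_simp
    exact (IsLipschitzSlidingSolution.scaled ha hP hN
      (mem_escapingRegion_scaled ha hP hN) hu).isSlidingPeriodicSolution
  · have hl0 : lam ≠ 0 := h.ne
    -- Near `9 * a / 2` the forcing changes sign, so for `lam < 0` the upper amplitude `-lam * ε` is
    -- positive and can serve as the parameter, again with ratio `lam⁻¹`.
    have hμ : 0 < -lam / a ^ 2 := div_pos (neg_pos.2 h) (by positivity)
    refine (hasSolutionsNear_escaping ((inv_lt_zero.2 h).trans one_pos) hinv).scaled ha hμ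
      fun ε hε u hu => ?_
    have hP : ∀ t, ε * (lam * Real.sin (Real.pi * t / (3 * a))) =
        a ^ 2 * (-lam / a ^ 2 * ε * forcing ((t - 9 * a / 2) / a)) := fun t => by
      rw [forcing_three_quarters ha]; field_simp
    have hN : ∀ t, ε * Real.sin (Real.pi * t / (3 * a)) =
        a ^ 2 * (-lam / a ^ 2 * ε * lam⁻¹ * forcing ((t - 9 * a / 2) / a)) := fun t => by
      rw [forcing_three_quarters ha]; field_simp
    exact (IsLipschitzSlidingSolution.scaled ha hP hN
      (mem_escapingRegion_scaled ha hP hN) hu).isSlidingPeriodicSolution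
  · refine (hasSolutionsNear_crossing h).scaled ha (μ := 1 / a ^ 2) (by positivity)
      fun ε hε u hu => ?_
    have hP : ∀ t, ε * (lam * Real.sin (Real.pi * t / (3 * a))) =
        a ^ 2 * (-(1 / a ^ 2 * ε * lam) * forcing ((t - 9 * a / 2) / a)) := fun t => by
      rw [forcing_three_quarters ha]; field_simp
    have hN : ∀ t, ε * Real.sin (Real.pi * t / (3 * a)) =
        a ^ 2 * (-(1 / a ^ 2 * ε) * forcing ((t - 9 * a / 2) / a)) := fun t => by
      rw [forcing_three_quarters ha]; field_simp
    exact IsLipschitzCrossingSolution.scaled ha hP hN hu
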